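/- A metrized graph $\Gamma$ is a finite connected non-empty graph (loops and multiple edges allowed), with vertex set $V(\Gamma)$ and edge set $E(\Gamma)$, in which each edge $e$ is identified with a segment $[0,L_e]$, $L_e>0$; its total length is $\ell(\Gamma)=\sum_{e} L_e$. It is normalized if $\ell(\Gamma)=1$, and $\Gamma^N$ denotes $\Gamma$ with all lengths divided by $\ell(\Gamma)$. For points $x,y,z\in\Gamma$ let $j_z(x,y)$ be the voltage function: $x\mapsto j_z(x,y)$ is the continuous piecewise affine function with $\Delta_x j_z(x,y)=\delta_y-\delta_z$ and $j_z(z,y)=0$ (the voltage at $x$, relative to $z$, when unit current enters at $y$ and exits at $z$ and each edge has resistance equal to its length). Let $r_\Gamma(x,y)=j_x(y,y)$ be the resistance function, and let $$A_{p,q,\Gamma}=\int_\Gamma j_x(p,q)\Big(\frac{d}{dx}j_p(x,q)\Big)^2dx .$$ The tau constant is $\tau(\Gamma)=\tfrac12\int_\Gamma j_\zeta(x,x)\,d\mu_{can}(\zeta)$, where $\mu_{can}$ is the unique real signed Borel measure of total mass $1$ on $\Gamma$ for which this integral does not depend on $x\in\Gamma$. For an edge $e_i$ of $\Gamma$ of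 length $L_i$, $R_i\in[0,\infty]$ is the resistance between the end points of $e_i$ in $\Gamma-e_i$ ($e_i$ with its interior removed); $R_i=\infty$, and $\frac1{L_i+R_i}=0$, if $\Gamma-e_i$ is disconnected. Let $\Gamma$ be a normalized metrized graph with edges $e_1,\dots,e_e$, each with a labelling of its end points as first and second. For each $i$ let $\beta^i$ be a normalized metrized graph and let $p_i\ne q_i$ be vertices of $\beta^i$. Let $\Gamma\star\prod_i\beta^i_{p_i,q_i}$ be the graph obtained from $\Gamma$ by replacing each edge $e_i$ by a copy of $\beta^i$ with all lengths multiplied by $L_i/r_{\beta^i}(p_i,q_i)$, identifying $p_i$ with the first and $q_i$ with the second end point of $e_i$. If $\beta^i=\beta$, $p_i=p$, $q_i=q$ for all $i$, it is denoted $\Gamma\star\beta_{p,q}$. (1) For normalized metrized graphs $\Gamma$ and $\beta$ and distinct vertices $p,q$ of $\beta$, $(\Gamma\star\beta_{p,q})^N$ is a normalized metrized graph and $$\tau\big((\Gamma\star\beta_{p,q})^N\big)=\tau(\beta)-\frac{r_\beta(p,q)}4+r_\beta(p,q)\,\tau(\Gamma)+\frac{A_{p,q,\beta}}{r_\beta(p,q)}\sum_{e_i\in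 E(\Gamma)}\frac{L_i^2}{L_i+R_i}.$$ (2) In general, $\big(\Gamma\star\prod_i\beta^i_{p_i,q_i}\big)^N$ is a normalized metrized graph and $$\tau\Big(\big(\Gamma\star\textstyle\prod_i\beta^i_{p_i,q_i}\big)^N\Big)\sum_{e_i\in E(\Gamma)}\frac{L_i}{r_{\beta^i}(p_i,q_i)}=\tau(\Gamma)-\frac14+\sum_{e_i\in E(\Gamma)}\left[\frac{L_i\,\tau(\beta^i)}{r_{\beta^i}(p_i,q_i)}+\frac{L_i^2\,A_{p_i,q_i,\beta^i}}{(L_i+R_i)\,r_{\beta^i}(p_i,q_i)^2}\right].$$ -/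

import Mathlib

open MeasureTheory Filter Topology Set
open scoped ENNReal

universe u

noncomputable section

/-- A finite multigraph (loops and multiple edges allowed) with oriented edges and a real length on
each edge.  The orientation records the parametrization of each edge (and thereby a labelling of its
end points).  Connectedness and positivity of lengths are in `LengthGraph.IsMetrizedGraph`. -/
structure LengthGraph where
  /-- vertices -/
  V : Type u
  /-- edges -/
  E : Type u
  finV : Finite V
  fintypeE : Fintype E
  /-- initial end point of an edge -/
  src : E → V
  /-- final end point of an edge -/
  tgt : E → V
  /-- length of an edge -/
  len : E → ℝ

namespace LengthGraph

attribute [instance] LengthGraph.finV LengthGraph.fintypeE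

/-- The graph is connected and non-empty. -/
def Connected (Γ : LengthGraph.{u}) : Prop :=
  Nonempty Γ.V ∧
    ∀ u v : Γ.V, Relation.EqvGen (fun a b => ∃ e : Γ.E, Γ.src e = a ∧ Γ.tgt e = b) u v

/-- Metrized graphs: finite connected graphs with positive edge lengths. -/
def IsMetrizedGraph (Γ : LengthGraph.{u}) : Prop :=
  Γ.Connected ∧ ∀ e : Γ.E, 0 < Γ.len e

/-- The total length `ℓ(Γ)`. -/
def totalLength (Γ : LengthGraph.{u}) : ℝ := ∑ e : Γ.E, Γ.len e

/-- A normalized metrized graph: one of total length `1`. -/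
def IsNormalized (Γ : LengthGraph.{u}) : Prop :=
  Γ.IsMetrizedGraph ∧ Γ.totalLength = 1

/-- Multiply every edge length by `c`. -/
def scale (Γ : LengthGraph.{u}) (c : ℝ) : LengthGraph.{u} :=
  { Γ with len := fun e => c * Γ.len e }

/-- The normalization `Γ^N`. -/
def normalization (Γ : LengthGraph.{u}) : LengthGraph.{u} :=
  Γ.scale (1 / Γ.totalLength)

open Classical in
/-- `Γ - e`: remove the interior of the edge `e`, keeping all vertices. -/
def deleteEdge (Γ : LengthGraph.{u}) (e : Γ.E) : LengthGraph.{u} where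
  V := Γ.V
  E := {e' : Γ.E // e' ≠ e}
  finV := inferInstance
  fintypeE := inferInstance
  src e' := Γ.src e'.1
  tgt e' := Γ.tgt e'.1
  len e' := Γ.len e'.1

/-! ### The underlying space -/

/-- The points of the metrized graph: the vertices, and the interior points of the edges, where
an edge `e` is parametrized by `[0, len e]`. -/
inductive Point (Γ : LengthGraph.{u}) : Type u
  | vertex (v : Γ.V) : Point Γ
  | interior (e : Γ.E) (t : ℝ) (ht : t ∈ Ioo 0 (Γ.len e)) : Point Γ

open Classical in
/-- The parametrization of the closed edge `e` by `[0, len e]`, from `src e` to `tgt e`, extended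
to `ℝ` as a constant on either side. -/
def param (Γ : LengthGraph.{u}) (e : Γ.E) (t : ℝ) : Γ.Point :=
  if h : t ∈ Ioo 0 (Γ.len e) then .interior e t h
  else if t ≤ 0 then .vertex (Γ.src e) else .vertex (Γ.tgt e)

/-- The quotient topology obtained by gluing the closed edges at the vertices: a set is open iff
its preimage under the parametrization of each edge is open. -/
instance (Γ : LengthGraph.{u}) : TopologicalSpace Γ.Point :=
  ⨆ e : Γ.E, TopologicalSpace.coinduced (Γ.param e) inferInstance

/-- The Borel sigma-algebra. -/
instance (Γ : LengthGraph.{u}) : MeasurableSpace Γ.Point := borel Γ.Point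

instance (Γ : LengthGraph.{u}) : BorelSpace Γ.Point := ⟨rfl⟩

/-- The integral `∫_Γ F dx`, where the integrand is given edge by edge in the coordinate of
the edge. -/
def edgeIntegral (Γ : LengthGraph.{u}) (F : Γ.E → ℝ → ℝ) : ℝ :=
  ∑ e : Γ.E, ∫ t in (0 : ℝ)..(Γ.len e), F e t

/-! ### Voltage and resistance -/

open Classical in
/-- The sum of the outgoing directional derivatives of `f` over all directions emanating from a
point. A loop contributes two directions at its vertex. -/
def slopeSum (Γ : LengthGraph.{u}) (f : Γ.Point → ℝ) : Γ.Point → ℝ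
  | .vertex v => ∑ e : Γ.E,
      ((if Γ.src e = v then derivWithin (fun s => f (Γ.param e s)) (Ici 0) 0 else 0) +
        (if Γ.tgt e = v then
          - derivWithin (fun s => f (Γ.param e s)) (Iic (Γ.len e)) (Γ.len e) else 0))
  | .interior e t _ => derivWithin (fun s => f (Γ.param e s)) (Ici t) t -
      derivWithin (fun s => f (Γ.param e s)) (Iic t) t

open Classical in
/-- `f` is the voltage (with reference voltage `0` at `z`) when unit current enters `Γ` at `y` and
exits at `z`: `f` is continuous, it is affine on the segments of the edges between consecutive
points among `y`, `z` and the vertices, and `Δ f = δ_y - δ_z`, where the mass of `Δ f` at a point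
is minus the sum of the outgoing slopes there. -/
structure IsVoltage (Γ : LengthGraph.{u}) (z y : Γ.Point) (f : Γ.Point → ℝ) : Prop where
  ref_eq_zero : f z = 0
  continuous : Continuous f
  locally_affine : ∀ (e : Γ.E) (t : ℝ), t ∈ Ioo 0 (Γ.len e) → Γ.param e t ≠ y → Γ.param e t ≠ z →
    ∃ c : ℝ, ∀ᶠ s in 𝓝 t, f (Γ.param e s) = f (Γ.param e t) + c * (s - t)
  kirchhoff : ∀ x : Γ.Point,
    - Γ.slopeSum f x = (if x = y then 1 else 0) - (if x = z then 1 else 0)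

/-- The voltage function `j_z(x, y)`. -/
def voltage (Γ : LengthGraph.{u}) (z x y : Γ.Point) : ℝ :=
  Classical.epsilon (fun f : Γ.Point → ℝ => Γ.IsVoltage z y f) x

/-- The resistance function `r(x, y) = j_x(y, y)`. -/
def resistance (Γ : LengthGraph.{u}) (x y : Γ.Point) : ℝ := Γ.voltage x y y

/-- `R_e`, the resistance between the end points of the edge `e` in `Γ - e`, equal to `∞` if
`e` is a bridge. -/
def edgeResistance (Γ : LengthGraph.{u}) (e : Γ.E) : ℝ≥0∞ :=
  open Classical in
  if (Γ.deleteEdge e).Connected then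
    ENNReal.ofReal ((Γ.deleteEdge e).resistance (.vertex (Γ.src e)) (.vertex (Γ.tgt e)))
  else ∞

/-- `1 / (L_e + R_e)`, which is `0` if `R_e = ∞`. -/
def invLenAddRes (Γ : LengthGraph.{u}) (e : Γ.E) : ℝ :=
  ((ENNReal.ofReal (Γ.len e) + Γ.edgeResistance e)⁻¹).toReal

/-- `A_{p,q,Γ} = ∫_Γ j_x(p,q) (d/dx j_p(x,q))² dx`. -/
def A (Γ : LengthGraph.{u}) (p q : Γ.Point) : ℝ :=
  Γ.edgeIntegral fun e t =>
    Γ.voltage (Γ.param e t) p q * (deriv (fun s => Γ.voltage p (Γ.param e s) q) t) ^ 2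

/-! ### The tau constant -/

/-- `j_μ(x, y) = ∫_Γ j_ζ(x, y) dμ(ζ)` for a finite signed Borel measure `μ`. -/
def voltageMeasure (Γ : LengthGraph.{u}) (μ : SignedMeasure Γ.Point) (x y : Γ.Point) : ℝ :=
  ∫ᵛ ζ, Γ.voltage ζ x y ∂<•μ

/-- The canonical measure: the signed Borel measure of total mass `1` for which `j_μ(x, x)` is
constant. -/
def IsCanonicalMeasure (Γ : LengthGraph.{u}) (μ : SignedMeasure Γ.Point) : Prop :=
  μ univ = 1 ∧ ∃ c : ℝ, ∀ x : Γ.Point, Γ.voltageMeasure μ x x = c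

/-- The tau constant: the constant value of `j_μ(x, x) / 2` for the canonical measure `μ`. -/
def tau (Γ : LengthGraph.{u}) : ℝ :=
  Classical.epsilon fun t : ℝ => ∃ μ : SignedMeasure Γ.Point,
    Γ.IsCanonicalMeasure μ ∧ ∀ x : Γ.Point, (1 / 2) * Γ.voltageMeasure μ x x = t

/-! ### Full immersion -/

/-- The scaled copy `β_e` of the graph assigned to the edge `e`, in which the resistance between
`p e` and `q e` equals the length of `e`. -/
def scaledCopy (Γ : LengthGraph.{u}) (β : Γ.E → LengthGraph.{u}) (p q : ∀ e, (β e).V) (e : Γ.E) :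
    LengthGraph.{u} :=
  (β e).scale (Γ.len e / (β e).resistance (.vertex (p e)) (.vertex (q e)))

/-- The vertices after the replacement: those of `Γ`, and the vertices of each copy `β_e` other
than `p e` and `q e`. -/
abbrev ImmersionVertex (Γ : LengthGraph.{u}) (β : Γ.E → LengthGraph.{u}) (p q : ∀ e, (β e).V) :
    Type u :=
  Γ.V ⊕ (Σ e : Γ.E, {v : (β e).V // v ≠ p e ∧ v ≠ q e})

open Classical in
/-- How the vertices of the copy `β_e` sit in the new graph: `p e` is identified with the initial
and `q e` with the final end point of `e`. -/
def immersionVertex (Γ : LengthGraph.{u}) (β : Γ.E → LengthGraph.{u}) (p q : ∀ e, (β e).V)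
    (e : Γ.E) (v : (β e).V) : Γ.ImmersionVertex β p q :=
  if hp : v = p e then .inl (Γ.src e)
  else if hq : v = q e then .inl (Γ.tgt e)
  else .inr ⟨e, v, hp, hq⟩

/-- The full immersion `Γ ⋆ ∏ β^e_{p_e,q_e}` (for `p e ≠ q e`): each edge `e` of `Γ` is replaced by
the scaled copy `β_e`. -/
def fullImmersion (Γ : LengthGraph.{u}) (β : Γ.E → LengthGraph.{u}) (p q : ∀ e, (β e).V) :
    LengthGraph.{u} where
  V := Γ.ImmersionVertex β p q
  E := Σ e : Γ.E, (β e).E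
  finV := inferInstance
  fintypeE := inferInstance
  src := fun a => Γ.immersionVertex β p q a.1 ((β a.1).src a.2)
  tgt := fun a => Γ.immersionVertex β p q a.1 ((β a.1).tgt a.2)
  len := fun a => (Γ.scaledCopy β p q a.1).len a.2

end LengthGraph

end

/-!
Let `g` be the reproducing kernel of the Dirichlet form on the functions on the vertices vanishing
at a vertex `o`. Extended affinely to the edges, plus the Green function of the segment
`min s t - s t / L` when both points are on the same edge, it becomes a kernel on all points, and
`j_z(x, y) = g(x, y) - g(x, z) - g(z, y) + g(z, z)`. The canonical measure is
`δ_o + Δ r(o, ·) / 2`, and integrating gives, with `a`, `b` the values of `g(x, x)` at the end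
points of `e` and `r_e` the resistance between them,
`4 τ(Γ) = ∑ ((b - a)² / L_e + (L_e - r_e)² / (3 L_e))`. Moreover `L_e - r_e = L_e² / (L_e + R_e)`.

Replace `e` by a copy `B` with resistance `L_e` between `p` and `q`. The Green function of the new
graph is harmonic inside `B` up to the Green function of `B` grounded at both `p` and `q`.
Therefore, if `h` is the potential in `B` from `p` to `q` and `κ = L_e - r_e`, its diagonal on `B`
differs from that of `B` itself by `a + (b - a) h + κ h (1 - h) - L_e h`, and a resistance across an
edge of `B` drops by `κ (Δh)²`. In the sum for `4 τ` the coefficient of `κ` is `4 A / L_e²`, and the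
remaining terms follow from testing the harmonic function `h` against functions of `h`.
-/

namespace LengthGraph

variable {Γ : LengthGraph.{u}}

/-! ### The Dirichlet form and Green functions on the vertices -/

/-- The Dirichlet form on functions on the vertices. -/
noncomputable def energy (Γ : LengthGraph.{u}) : LinearMap.BilinForm ℝ (Γ.V → ℝ) :=
  let value (v : Γ.V) : (Γ.V → ℝ) →ₗ[ℝ] ℝ := LinearMap.proj (φ := fun _ : Γ.V => ℝ) v
  let increment (e : Γ.E) : (Γ.V → ℝ) →ₗ[ℝ] ℝ := value (Γ.tgt e) - value (Γ.src e)
  ∑ e : Γ.E, (Γ.len e)⁻¹ • (LinearMap.mul ℝ ℝ).compl₁₂ (increment e) (increment e)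

theorem energy_apply (F H : Γ.V → ℝ) : Γ.energy F H =
    ∑ e : Γ.E, (F (Γ.tgt e) - F (Γ.src e)) * (H (Γ.tgt e) - H (Γ.src e)) / Γ.len e := by
  simp only [energy, LinearMap.sum_apply, LinearMap.smul_apply, LinearMap.compl₁₂_apply,
    LinearMap.mul_apply', LinearMap.sub_apply, LinearMap.proj_apply, smul_eq_mul]
  exact Finset.sum_congr rfl fun e _ => by ring

theorem energy_comm (F H : Γ.V → ℝ) : Γ.energy F H = Γ.energy H F := by
  simp only [energy_apply, mul_comm (F _ - _)]

theorem energy_self_nonneg (hl : ∀ e, 0 < Γ.len e) (F : Γ.V → ℝ) : 0 ≤ Γ.energy F F := by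
  rw [energy_apply]
  exact Finset.sum_nonneg fun e _ => div_nonneg (mul_self_nonneg _) (hl e).le

theorem energy_const_left (c : ℝ) (F : Γ.V → ℝ) : Γ.energy (fun _ => c) F = 0 := by
  simp [energy_apply]

theorem energy_const_right (c : ℝ) (F : Γ.V → ℝ) : Γ.energy F (fun _ => c) = 0 := by
  rw [energy_comm, energy_const_left]

/-- The relation of being joined by an edge, whose generated equivalence relation is the one in
`LengthGraph.Connected`. -/
def EdgeRel (Γ : LengthGraph.{u}) (a b : Γ.V) : Prop := ∃ e : Γ.E, Γ.src e = a ∧ Γ.tgt e = b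

theorem eq_of_eqvGen_of_forall_edge {α : Type*} {F : Γ.V → α}
    (hF : ∀ e, F (Γ.src e) = F (Γ.tgt e)) {u v : Γ.V} (h : Relation.EqvGen Γ.EdgeRel u v) :
    F u = F v := by
  induction h with
  | rel x y h => obtain ⟨e, rfl, rfl⟩ := h; exact hF e
  | refl x => rfl
  | symm x y _ ih => exact ih.symm
  | trans x y z _ _ ih₁ ih₂ => exact ih₁.trans ih₂

theorem IsMetrizedGraph.eq_of_energy_self_eq_zero (hΓ : Γ.IsMetrizedGraph) {F : Γ.V → ℝ}
    (hF : Γ.energy F F = 0) (u v : Γ.V) : F u = F v := by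
  refine eq_of_eqvGen_of_forall_edge (fun e => ?_) (hΓ.1.2 u v)
  rw [energy_apply, Finset.sum_eq_zero_iff_of_nonneg
    fun e _ => div_nonneg (mul_self_nonneg _) (hΓ.2 e).le] at hF
  have h := (div_eq_zero_iff.1 (hF e (Finset.mem_univ _))).resolve_right (hΓ.2 e).ne'
  exact (sub_eq_zero.1 (mul_self_eq_zero.1 h)).symm

/-- `g` is the Green function of `Γ` grounded at `o`: `g y` is the potential, relative to `o`, when
unit current enters at `y` and exits at `o`. Equivalently, `g` is the reproducing kernel of the
Dirichlet form on the functions vanishing at `o`. -/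
structure IsGreen (Γ : LengthGraph.{u}) (o : Γ.V) (g : Γ.V → Γ.V → ℝ) : Prop where
  ground : ∀ y, g y o = 0
  energy_eq : ∀ y F, Γ.energy (g y) F = F y - F o

theorem IsMetrizedGraph.exists_isGreen (hΓ : Γ.IsMetrizedGraph) (o : Γ.V) :
    ∃ g, Γ.IsGreen o g := by
  let W : Submodule ℝ (Γ.V → ℝ) := LinearMap.ker (LinearMap.proj (R := ℝ) (φ := fun _ : Γ.V => ℝ) o)
  have hW : ∀ F : W, F.1 o = 0 := fun F => F.2
  have hB : (Γ.energy.restrict W).Nondegenerate := by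
    have hsymm : (Γ.energy.restrict W).IsSymm := ⟨fun F H => energy_comm F.1 H.1⟩
    refine hsymm.isRefl.nondegenerate_iff_separatingLeft.2 fun F hF => ?_
    ext v
    exact (hΓ.eq_of_energy_self_eq_zero (hF F) v o).trans (hW F)
  let potential (y : Γ.V) : W :=
    (LinearMap.BilinForm.toDual _ hB).symm ((LinearMap.proj y).comp W.subtype)
  refine ⟨fun y => (potential y).1, fun y => hW _, fun y F => ?_⟩
  have h := LinearMap.BilinForm.apply_toDual_symm_apply (hB := hB)
    ((LinearMap.proj y).comp W.subtype) ⟨F - fun _ => F o, by simp [W]⟩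
  change Γ.energy (potential y).1 (F - fun _ => F o) = F y - F o at h
  rwa [map_sub, energy_const_right, sub_zero] at h

/-- The resistance between two points in terms of a Green function. -/
def kernelRes {α : Type*} (g : α → α → ℝ) (x y : α) : ℝ := g x x + g y y - 2 * g x y

namespace IsGreen

variable {o : Γ.V} {g : Γ.V → Γ.V → ℝ}

theorem symm (hg : Γ.IsGreen o g) (x y : Γ.V) : g x y = g y x := by
  have hxy := hg.energy_eq y (g x)
  have hyx := hg.energy_eq x (g y)
  rw [energy_comm, hg.ground] at hyx
  rw [hg.ground] at hxy
  linarith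

theorem ground_left (hg : Γ.IsGreen o g) (y : Γ.V) : g o y = 0 := by
  rw [hg.symm, hg.ground]

theorem energy_self (hg : Γ.IsGreen o g) (x : Γ.V) : Γ.energy (g x) (g x) = g x x := by
  rw [hg.energy_eq, hg.ground, sub_zero]

theorem diag_nonneg (hg : Γ.IsGreen o g) (hl : ∀ e, 0 < Γ.len e) (x : Γ.V) : 0 ≤ g x x :=
  hg.energy_self x ▸ energy_self_nonneg hl _

theorem diag_pos (hg : Γ.IsGreen o g) (hΓ : Γ.IsMetrizedGraph) {x : Γ.V} (hx : x ≠ o) :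
    0 < g x x := by
  refine (hg.diag_nonneg hΓ.2 x).lt_of_ne fun h0 => ?_
  have hconst := hΓ.eq_of_energy_self_eq_zero ((hg.energy_self x).trans h0.symm)
  classical
  have h := hg.energy_eq x (Pi.single x 1)
  rw [show g x = fun _ => g x o from funext fun v => hconst v o, energy_const_left] at h
  simp [hx.symm] at h

end IsGreen

/-! ### Affine germs -/

/-- Along the filter `l`, the function `φ` is affine of slope `c` with value `φ t` at `t`. It is
used for `l = 𝓝[≥] t`, `𝓝[≤] t` and `𝓝 t`. -/
def HasAffineGerm (l : Filter ℝ) (φ : ℝ → ℝ) (t c : ℝ) : Prop := ∀ᶠ s in l, φ s = φ t + c * (s - t)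

namespace HasAffineGerm

variable {φ ψ : ℝ → ℝ} {l l' : Filter ℝ} {s : Set ℝ} {t c d : ℝ}

theorem derivWithin_eq (h : HasAffineGerm (𝓝[s] t) φ t c) (ht : t ∈ s)
    (hs : UniqueDiffWithinAt ℝ s t) : derivWithin φ s t = c := by
  have haff : HasDerivWithinAt (fun r => φ t + c * (r - t)) c s t := by
    simpa using ((((hasDerivAt_id t).sub_const t).const_mul c).const_add (φ t)).hasDerivWithinAt
  exact (haff.congr_of_eventuallyEq_of_mem h ht).derivWithin hs

theorem add (h : HasAffineGerm l φ t c) (h' : HasAffineGerm l ψ t d) :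
    HasAffineGerm l (fun s => φ s + ψ s) t (c + d) := by
  filter_upwards [h, h'] with s hφ hψ
  rw [hφ, hψ]; ring

theorem sub (h : HasAffineGerm l φ t c) (h' : HasAffineGerm l ψ t d) :
    HasAffineGerm l (fun s => φ s - ψ s) t (c - d) := by
  filter_upwards [h, h'] with s hφ hψ
  rw [hφ, hψ]; ring

theorem nhds (hr : HasAffineGerm (𝓝[≥] t) φ t c) (hl : HasAffineGerm (𝓝[≤] t) φ t c) :
    HasAffineGerm (𝓝 t) φ t c := by
  rw [HasAffineGerm, ← nhdsLE_sup_nhdsGE, eventually_sup]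
  exact ⟨hl, hr⟩

theorem eventually_hasDerivAt (h : HasAffineGerm (𝓝 t) φ t c) : ∀ᶠ s in 𝓝 t, HasDerivAt φ c s :=
  h.eventually_nhds.mono fun s hs => by
    have haff : HasDerivAt (fun r => φ t + c * (r - t)) c s := by
      simpa using (((hasDerivAt_id s).sub_const t).const_mul c).const_add (φ t)
    exact haff.congr_of_eventuallyEq hs

end HasAffineGerm

section LocallyAffine

variable {φ : ℝ → ℝ} {a b t : ℝ}

theorem exists_hasDerivAt_Ioo_of_hasAffineGerm
    (h : ∀ t ∈ Ioo a b, ∃ c, HasAffineGerm (𝓝 t) φ t c) : ∃ c, ∀ t ∈ Ioo a b, HasDerivAt φ c t := by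
  rcases (Ioo a b).eq_empty_or_nonempty with hab | ⟨t₀, ht₀⟩
  · simp [hab]
  have hderiv : ∀ t ∈ Ioo a b, HasDerivAt (deriv φ) 0 t := fun t ht => by
    obtain ⟨c, hc⟩ := h t ht
    exact (hasDerivAt_const t c).congr_of_eventuallyEq
      (hc.eventually_hasDerivAt.mono fun _ hs => hs.deriv)
  refine ⟨deriv φ t₀, fun t ht => ?_⟩
  rw [isOpen_Ioo.is_const_of_deriv_eq_zero isPreconnected_Ioo
    (fun s hs => (hderiv s hs).differentiableAt.differentiableWithinAt)
    (fun s hs => (hderiv s hs).deriv) ht₀ ht]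
  obtain ⟨c, hc⟩ := h t ht
  exact hc.eventually_hasDerivAt.self_of_nhds.differentiableAt.hasDerivAt

theorem exists_affineOn_Icc_of_hasAffineGerm (hφ : ContinuousOn φ (Icc a b))
    (h : ∀ t ∈ Ioo a b, ∃ c, HasAffineGerm (𝓝 t) φ t c) :
    ∃ c, ∀ s ∈ Icc a b, ∀ t ∈ Icc a b, φ s = φ t + c * (s - t) := by
  obtain ⟨c, hc⟩ := exists_hasDerivAt_Ioo_of_hasAffineGerm h
  have hleft : ∀ s ∈ Icc a b, φ s = φ a + c * (s - a) := fun s hs => by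
    rcases hs.1.eq_or_lt with rfl | has
    · simp
    obtain ⟨x, -, hx⟩ := exists_hasDerivAt_eq_slope φ (fun _ => c) has
      (hφ.mono (Icc_subset_Icc_right hs.2)) fun x hx => hc x ⟨hx.1, hx.2.trans_le hs.2⟩
    rw [hx, div_mul_cancel₀ _ (sub_pos.2 has).ne']
    ring
  refine ⟨c, fun s hs t ht => ?_⟩
  rw [hleft s hs, hleft t ht]
  ring

theorem exists_hasAffineGerm_nhdsGE (hφ : Continuous φ)
    (h : ∀ᶠ s in 𝓝[>] t, ∃ c, HasAffineGerm (𝓝 s) φ s c) :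
    ∃ c, HasAffineGerm (𝓝[≥] t) φ t c := by
  obtain ⟨b, hb, hsub⟩ := mem_nhdsGT_iff_exists_Ioo_subset.1 h
  obtain ⟨c, hc⟩ := exists_affineOn_Icc_of_hasAffineGerm hφ.continuousOn hsub
  exact ⟨c, mem_of_superset (Icc_mem_nhdsGE hb) fun s hs =>
    hc s hs t (left_mem_Icc.2 (le_of_lt hb))⟩

theorem exists_hasAffineGerm_nhdsLE (hφ : Continuous φ)
    (h : ∀ᶠ s in 𝓝[<] t, ∃ c, HasAffineGerm (𝓝 s) φ s c) :
    ∃ c, HasAffineGerm (𝓝[≤] t) φ t c := by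
  obtain ⟨a, ha, hsub⟩ := mem_nhdsLT_iff_exists_Ioo_subset.1 h
  obtain ⟨c, hc⟩ := exists_affineOn_Icc_of_hasAffineGerm hφ.continuousOn hsub
  exact ⟨c, mem_of_superset (Icc_mem_nhdsLE ha) fun s hs =>
    hc s hs t (right_mem_Icc.2 (le_of_lt ha))⟩

end LocallyAffine

/-! ### Points of a metrized graph -/

theorem param_of_mem {e : Γ.E} {t : ℝ} (ht : t ∈ Ioo 0 (Γ.len e)) :
    Γ.param e t = .interior e t ht := by
  simp [param, ht]

theorem param_zero (e : Γ.E) : Γ.param e 0 = .vertex (Γ.src e) := by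
  simp [param]

theorem param_len {e : Γ.E} (he : 0 < Γ.len e) : Γ.param e (Γ.len e) = .vertex (Γ.tgt e) := by
  simp [param, he]

theorem param_projIcc {e : Γ.E} (he : 0 < Γ.len e) (s : ℝ) :
    Γ.param e (projIcc 0 (Γ.len e) he.le s) = Γ.param e s := by
  rcases le_or_gt s 0 with h0 | h0
  · rw [projIcc_of_le_left _ h0]
    simp [param, h0, h0.not_gt]
  rcases lt_or_ge s (Γ.len e) with hL | hL
  · rw [projIcc_of_mem _ ⟨h0.le, hL.le⟩]
  · rw [projIcc_of_right_le _ hL]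
    simp [param, hL.not_gt, he.not_ge, h0.not_ge]

theorem param_eq_interior_iff {e e' : Γ.E} {s t : ℝ} {ht : t ∈ Ioo 0 (Γ.len e')} :
    Γ.param e s = .interior e' t ht ↔ e = e' ∧ s = t := by
  unfold param
  split_ifs with h1 h2
  · simp only [Point.interior.injEq]
  all_goals
    simp only [false_iff]
    rintro ⟨rfl, rfl⟩
    exact h1 ht

theorem vertex_or_exists_param (x : Γ.Point) :
    (∃ v, x = .vertex v) ∨ ∃ e, ∃ t ∈ Ioo 0 (Γ.len e), x = Γ.param e t := by
  rcases x with v | ⟨e, t, ht⟩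
  · exact .inl ⟨v, rfl⟩
  · exact .inr ⟨e, t, ht, (param_of_mem ht).symm⟩

theorem continuous_param (e : Γ.E) : Continuous (Γ.param e) :=
  continuous_iSup_rng (i := e) continuous_coinduced_rng

theorem continuous_of_forall_continuousOn_edge (hl : ∀ e, 0 < Γ.len e) {α : Type*}
    [TopologicalSpace α] {f : Γ.Point → α}
    (hf : ∀ e, ContinuousOn (fun s => f (Γ.param e s)) (Icc 0 (Γ.len e))) : Continuous f := by
  refine continuous_iSup_dom.2 fun e => continuous_coinduced_dom.2 ?_
  convert (continuousOn_iff_continuous_domRestrict.1 (hf e)).comp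
    (continuous_projIcc (h := (hl e).le)) using 1
  exact funext fun s => congrArg f (param_projIcc (hl e) s).symm

/-- The function on `Γ` that is affine on each edge with given values at the vertices. -/
noncomputable def interp (u : Γ.V → ℝ) : Γ.Point → ℝ
  | .vertex v => u v
  | .interior e t _ => u (Γ.src e) + (u (Γ.tgt e) - u (Γ.src e)) / Γ.len e * t

open Classical in
/-- The coordinate along the edge `e`, set to `0` off the interior of `e`. -/
noncomputable def edgeCoord (e : Γ.E) : Γ.Point → ℝ
  | .vertex _ => 0
  | .interior e' t _ => if e' = e then t else 0

/-- The Green function `min s a - s a / L` of the segment `[0, L]` with Dirichlet boundary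
conditions. -/
noncomputable def segmentGreen (L a s : ℝ) : ℝ := min s a - s * a / L

/-- The Green function of `Γ` with Dirichlet boundary conditions at all vertices. The terms of the
edges not containing both points vanish by the convention on `edgeCoord`. -/
noncomputable def bump (x y : Γ.Point) : ℝ :=
  ∑ e : Γ.E, segmentGreen (Γ.len e) (edgeCoord e y) (edgeCoord e x)

theorem interp_param {e : Γ.E} {t : ℝ} (ht : t ∈ Icc 0 (Γ.len e)) (he : 0 < Γ.len e)
    (u : Γ.V → ℝ) : interp u (Γ.param e t) =
      u (Γ.src e) + (u (Γ.tgt e) - u (Γ.src e)) / Γ.len e * t := by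
  rcases ht.1.eq_or_lt with rfl | h0
  · simp [param_zero, interp]
  rcases ht.2.eq_or_lt with rfl | hL
  · simp [param_len he, interp, he.ne']
  · rw [param_of_mem ⟨h0, hL⟩]; rfl

theorem edgeCoord_param_of_ne {e e' : Γ.E} (h : e ≠ e') (t : ℝ) :
    edgeCoord e' (Γ.param e t) = 0 := by
  unfold param
  split_ifs <;> simp [edgeCoord, h]

theorem edgeCoord_param {e : Γ.E} {t : ℝ} (ht : t ∈ Ioo 0 (Γ.len e)) :
    edgeCoord e (Γ.param e t) = t := by
  simp [param_of_mem ht, edgeCoord]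

theorem edgeCoord_mem_Ico (hl : ∀ e, 0 < Γ.len e) (e : Γ.E) (x : Γ.Point) :
    edgeCoord e x ∈ Ico 0 (Γ.len e) := by
  rcases x with _ | ⟨e', t, ht⟩
  · exact left_mem_Ico.2 (hl e)
  · by_cases h : e' = e
    · subst h; simpa [edgeCoord] using ⟨ht.1.le, ht.2⟩
    · simpa [edgeCoord, h] using hl e

theorem sum_edgeCoord_param {φ : Γ.E → ℝ → ℝ} (h0 : ∀ e, φ e 0 = 0) {e : Γ.E}
    (hL : φ e (Γ.len e) = 0) {t : ℝ} (ht : t ∈ Icc 0 (Γ.len e)) (he : 0 < Γ.len e) :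
    ∑ e', φ e' (edgeCoord e' (Γ.param e t)) = φ e t := by
  rw [Finset.sum_eq_single e (fun e' _ he' => by rw [edgeCoord_param_of_ne he'.symm, h0]) (by simp)]
  rcases ht.1.eq_or_lt with rfl | h0'
  · simp [param_zero, edgeCoord]
  rcases ht.2.eq_or_lt with rfl | hL'
  · rw [param_len he, edgeCoord, h0, hL]
  · rw [edgeCoord_param ⟨h0', hL'⟩]

theorem segmentGreen_zero {L a : ℝ} (ha : 0 ≤ a) : segmentGreen L a 0 = 0 := by
  simp [segmentGreen, ha]

theorem segmentGreen_len {L a : ℝ} (hL : 0 < L) (ha : a ≤ L) : segmentGreen L a L = 0 := by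
  rw [segmentGreen, min_eq_right ha, mul_div_cancel_left₀ _ hL.ne', sub_self]

theorem bump_param (hl : ∀ e, 0 < Γ.len e) {e : Γ.E} {t : ℝ} (ht : t ∈ Icc 0 (Γ.len e))
    (y : Γ.Point) : bump (Γ.param e t) y = segmentGreen (Γ.len e) (edgeCoord e y) t :=
  sum_edgeCoord_param (φ := fun e => segmentGreen (Γ.len e) (edgeCoord e y))
    (fun e => segmentGreen_zero (edgeCoord_mem_Ico hl e y).1)
    (segmentGreen_len (hl e) (edgeCoord_mem_Ico hl e y).2.le) ht (hl e)

theorem bump_comm (x y : Γ.Point) : bump x y = bump y x := by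
  simp only [bump, segmentGreen, min_comm, mul_comm]

theorem continuous_interp (hl : ∀ e, 0 < Γ.len e) (u : Γ.V → ℝ) : Continuous (interp u) :=
  continuous_of_forall_continuousOn_edge hl fun e =>
    ContinuousOn.congr (Continuous.continuousOn (by fun_prop)) fun _ ht =>
      interp_param ht (hl e) u

theorem continuous_bump (hl : ∀ e, 0 < Γ.len e) (y : Γ.Point) : Continuous fun x => bump x y :=
  continuous_of_forall_continuousOn_edge hl fun e =>
    ContinuousOn.congr (Continuous.continuousOn (by unfold segmentGreen; fun_prop)) fun _ ht =>
      bump_param hl ht y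

/-! ### Slopes along the edges -/

/-- At each point, `f` is affine on either side along each edge, with right slopes `R` and left
slopes `S` in the coordinates of the edges. -/
structure HasSlopes (f : Γ.Point → ℝ) (R S : Γ.E → ℝ → ℝ) : Prop where
  right : ∀ e, ∀ t ∈ Ico 0 (Γ.len e), HasAffineGerm (𝓝[≥] t) (fun s => f (Γ.param e s)) t (R e t)
  left : ∀ e, ∀ t ∈ Ioc 0 (Γ.len e), HasAffineGerm (𝓝[≤] t) (fun s => f (Γ.param e s)) t (S e t)

namespace HasSlopes

variable {f f' : Γ.Point → ℝ} {R S R' S' : Γ.E → ℝ → ℝ}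

theorem add (h : HasSlopes f R S) (h' : HasSlopes f' R' S') :
    HasSlopes (fun x => f x + f' x) (fun e t => R e t + R' e t) (fun e t => S e t + S' e t) :=
  ⟨fun e t ht => (h.right e t ht).add (h'.right e t ht),
    fun e t ht => (h.left e t ht).add (h'.left e t ht)⟩

theorem sub (h : HasSlopes f R S) (h' : HasSlopes f' R' S') :
    HasSlopes (fun x => f x - f' x) (fun e t => R e t - R' e t) (fun e t => S e t - S' e t) :=
  ⟨fun e t ht => (h.right e t ht).sub (h'.right e t ht),
    fun e t ht => (h.left e t ht).sub (h'.left e t ht)⟩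

open Classical in
theorem slopeSum_vertex (h : HasSlopes f R S) (hl : ∀ e, 0 < Γ.len e) (v : Γ.V) :
    Γ.slopeSum f (.vertex v) = ∑ e : Γ.E, ((if Γ.src e = v then R e 0 else 0) +
      (if Γ.tgt e = v then - S e (Γ.len e) else 0)) :=
  Finset.sum_congr rfl fun e _ => by
    rw [(h.right e 0 ⟨le_rfl, hl e⟩).derivWithin_eq self_mem_Ici (uniqueDiffWithinAt_Ici 0),
      (h.left e _ ⟨hl e, le_rfl⟩).derivWithin_eq self_mem_Iic (uniqueDiffWithinAt_Iic _)]

theorem slopeSum_interior (h : HasSlopes f R S) (e : Γ.E) (t : ℝ) (ht : t ∈ Ioo 0 (Γ.len e)) :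
    Γ.slopeSum f (.interior e t ht) = R e t - S e t := by
  simp only [slopeSum]
  rw [(h.right e t ⟨ht.1.le, ht.2⟩).derivWithin_eq self_mem_Ici (uniqueDiffWithinAt_Ici t),
    (h.left e t ⟨ht.1, ht.2.le⟩).derivWithin_eq self_mem_Iic (uniqueDiffWithinAt_Iic t)]

theorem slopeSum_add (h : HasSlopes f R S) (h' : HasSlopes f' R' S') (hl : ∀ e, 0 < Γ.len e)
    (x : Γ.Point) :
    Γ.slopeSum (fun x => f x + f' x) x = Γ.slopeSum f x + Γ.slopeSum f' x := by
  rcases x with v | ⟨e, t, ht⟩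
  · rw [(h.add h').slopeSum_vertex hl, h.slopeSum_vertex hl, h'.slopeSum_vertex hl,
      ← Finset.sum_add_distrib]
    refine Finset.sum_congr rfl fun e _ => ?_
    split_ifs <;> ring
  · rw [(h.add h').slopeSum_interior, h.slopeSum_interior, h'.slopeSum_interior]
    ring

theorem slopeSum_sub (h : HasSlopes f R S) (h' : HasSlopes f' R' S') (hl : ∀ e, 0 < Γ.len e)
    (x : Γ.Point) :
    Γ.slopeSum (fun x => f x - f' x) x = Γ.slopeSum f x - Γ.slopeSum f' x := by
  have h_add := (h.sub h').slopeSum_add h' hl x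
  simp only [sub_add_cancel] at h_add
  linarith

theorem hasAffineGerm_nhds (h : HasSlopes f R S) {e : Γ.E} {t : ℝ} (ht : t ∈ Ioo 0 (Γ.len e))
    (hRS : R e t = S e t) : HasAffineGerm (𝓝 t) (fun s => f (Γ.param e s)) t (R e t) :=
  (h.right e t ⟨ht.1.le, ht.2⟩).nhds (hRS ▸ h.left e t ⟨ht.1, ht.2.le⟩)

theorem of_forall_edge {φ : Γ.E → ℝ → ℝ} (hf : ∀ e, ∀ t ∈ Icc 0 (Γ.len e), f (Γ.param e t) = φ e t)
    (hR : ∀ e, ∀ t ∈ Ico 0 (Γ.len e), HasAffineGerm (𝓝[≥] t) (φ e) t (R e t))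
    (hS : ∀ e, ∀ t ∈ Ioc 0 (Γ.len e), HasAffineGerm (𝓝[≤] t) (φ e) t (S e t)) :
    HasSlopes f R S where
  right e t ht := by
    filter_upwards [hR e t ht, Icc_mem_nhdsGE ht.2] with s hφ hs
    rw [hf e s ⟨ht.1.trans hs.1, hs.2⟩, hf e t ⟨ht.1, ht.2.le⟩, hφ]
  left e t ht := by
    filter_upwards [hS e t ht, Icc_mem_nhdsLE ht.1] with s hφ hs
    rw [hf e s ⟨hs.1, hs.2.trans ht.2⟩, hf e t ⟨ht.1.le, ht.2⟩, hφ]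

end HasSlopes

theorem hasSlopes_const (c : ℝ) : HasSlopes (fun _ : Γ.Point => c) (fun _ _ => 0) (fun _ _ => 0) :=
  ⟨fun _ _ _ => .of_forall fun _ => by simp, fun _ _ _ => .of_forall fun _ => by simp⟩

theorem slopeSum_const (c : ℝ) (hl : ∀ e, 0 < Γ.len e) (x : Γ.Point) :
    Γ.slopeSum (fun _ => c) x = 0 := by
  rcases x with v | ⟨e, t, ht⟩
  · simp [(hasSlopes_const c).slopeSum_vertex hl]
  · simp [(hasSlopes_const c).slopeSum_interior]

theorem hasSlopes_interp (hl : ∀ e, 0 < Γ.len e) (u : Γ.V → ℝ) :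
    HasSlopes (interp u) (fun e _ => (u (Γ.tgt e) - u (Γ.src e)) / Γ.len e)
      (fun e _ => (u (Γ.tgt e) - u (Γ.src e)) / Γ.len e) :=
  .of_forall_edge (fun e _ ht => interp_param ht (hl e) u)
    (fun e t _ => .of_forall fun s => by ring) (fun e t _ => .of_forall fun s => by ring)

theorem hasAffineGerm_segmentGreen_right (L a t : ℝ) :
    HasAffineGerm (𝓝[≥] t) (segmentGreen L a) t ((if t < a then 1 else 0) - a / L) := by
  rcases lt_or_ge t a with h | h
  · filter_upwards [mem_nhdsWithin_of_mem_nhds (Iio_mem_nhds h)] with s hs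
    rw [segmentGreen, segmentGreen, min_eq_left hs.le, min_eq_left h.le, if_pos h]
    ring
  · filter_upwards [self_mem_nhdsWithin] with s hs
    rw [segmentGreen, segmentGreen, min_eq_right (h.trans hs), min_eq_right h, if_neg h.not_gt]
    ring

theorem hasAffineGerm_segmentGreen_left (L a t : ℝ) :
    HasAffineGerm (𝓝[≤] t) (segmentGreen L a) t ((if t ≤ a then 1 else 0) - a / L) := by
  rcases lt_or_ge a t with h | h
  · filter_upwards [mem_nhdsWithin_of_mem_nhds (Ioi_mem_nhds h)] with s hs
    rw [segmentGreen, segmentGreen, min_eq_right hs.le, min_eq_right h.le, if_neg h.not_ge]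
    ring
  · filter_upwards [self_mem_nhdsWithin] with s hs
    rw [segmentGreen, segmentGreen, min_eq_left (le_trans hs h), min_eq_left h, if_pos h]
    ring

theorem hasSlopes_bump (hl : ∀ e, 0 < Γ.len e) (y : Γ.Point) :
    HasSlopes (fun x => bump x y)
      (fun e t => (if t < edgeCoord e y then 1 else 0) - edgeCoord e y / Γ.len e)
      (fun e t => (if t ≤ edgeCoord e y then 1 else 0) - edgeCoord e y / Γ.len e) :=
  .of_forall_edge (fun _ _ ht => bump_param hl ht y)
    (fun _ t _ => hasAffineGerm_segmentGreen_right _ _ t)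
    (fun _ t _ => hasAffineGerm_segmentGreen_left _ _ t)

theorem slopeSum_interp_vertex [DecidableEq Γ.V] (hl : ∀ e, 0 < Γ.len e) (u : Γ.V → ℝ) (v : Γ.V) :
    Γ.slopeSum (interp u) (.vertex v) = - Γ.energy u (Pi.single v 1) := by
  rw [(hasSlopes_interp hl u).slopeSum_vertex hl, energy_apply, ← Finset.sum_neg_distrib]
  refine Finset.sum_congr rfl fun e _ => ?_
  simp only [Pi.single_apply]
  split_ifs <;> ring

theorem slopeSum_interp_interior (hl : ∀ e, 0 < Γ.len e) (u : Γ.V → ℝ) (e : Γ.E) (t : ℝ)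
    (ht : t ∈ Ioo 0 (Γ.len e)) : Γ.slopeSum (interp u) (.interior e t ht) = 0 := by
  rw [(hasSlopes_interp hl u).slopeSum_interior, sub_self]

open Classical in
theorem slopeSum_bump_vertex (hl : ∀ e, 0 < Γ.len e) (y : Γ.Point) (v : Γ.V) :
    Γ.slopeSum (fun x => bump x y) (.vertex v) =
      interp (Pi.single v 1) y - if Point.vertex v = y then 1 else 0 := by
  rw [(hasSlopes_bump hl y).slopeSum_vertex hl]
  rcases y with w | ⟨e, t, ht⟩
  · simp [edgeCoord, interp, Pi.single_apply, (hl _).not_ge, eq_comm]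
  · rw [Finset.sum_eq_single e (fun e' _ he => by simp [edgeCoord, he.symm, (hl e').not_ge])
      (by simp)]
    simp only [edgeCoord, interp, Pi.single_apply, if_true, ht.1, ht.2.not_ge, if_false,
      reduceCtorEq]
    split_ifs <;> ring

open Classical in
theorem slopeSum_bump_interior (hl : ∀ e, 0 < Γ.len e) (y : Γ.Point) (e : Γ.E) (t : ℝ)
    (ht : t ∈ Ioo 0 (Γ.len e)) :
    Γ.slopeSum (fun x => bump x y) (.interior e t ht) =
      - if Point.interior e t ht = y then 1 else 0 := by
  rw [(hasSlopes_bump hl _).slopeSum_interior]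
  rcases y with v | ⟨e', s, hs⟩
  · simp [edgeCoord, ht.1.not_gt, ht.1.not_ge]
  · by_cases he : e' = e
    · subst he
      rcases lt_trichotomy t s with h | rfl | h
      · simp [edgeCoord, h, h.le, h.ne]
      · simp [edgeCoord]; ring
      · simp [edgeCoord, h.not_ge, h.not_gt, h.ne']
    · simp [edgeCoord, he, Ne.symm he, ht.1.not_gt, ht.1.not_ge]

/-! ### The voltage function in terms of a Green function -/

/-- The extension to `Γ` of a Green function on the vertices. -/
noncomputable def kernel (g : Γ.V → Γ.V → ℝ) (x y : Γ.Point) : ℝ :=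
  interp (fun v => interp (g v) y) x + bump x y

/-- The voltage function `j_z(x, y)` expressed by a Green function. -/
noncomputable def kernelVoltage (g : Γ.V → Γ.V → ℝ) (z x y : Γ.Point) : ℝ :=
  kernel g x y - kernel g x z + (kernel g z z - kernel g z y)

theorem continuous_kernel (hl : ∀ e, 0 < Γ.len e) (g : Γ.V → Γ.V → ℝ) (y : Γ.Point) :
    Continuous fun x => kernel g x y :=
  (continuous_interp hl _).add (continuous_bump hl y)

theorem hasSlopes_kernel (hl : ∀ e, 0 < Γ.len e) (g : Γ.V → Γ.V → ℝ) (y : Γ.Point) :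
    HasSlopes (fun x => kernel g x y)
      (fun e t => (interp (g (Γ.tgt e)) y - interp (g (Γ.src e)) y) / Γ.len e +
        ((if t < edgeCoord e y then 1 else 0) - edgeCoord e y / Γ.len e))
      (fun e t => (interp (g (Γ.tgt e)) y - interp (g (Γ.src e)) y) / Γ.len e +
        ((if t ≤ edgeCoord e y then 1 else 0) - edgeCoord e y / Γ.len e)) :=
  (hasSlopes_interp hl _).add (hasSlopes_bump hl y)

theorem interp_interp_comm (g : Γ.V → Γ.V → ℝ) (x y : Γ.Point) :
    interp (fun v => interp (g v) y) x = interp (fun w => interp (fun v => g v w) x) y := by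
  rcases x with v | ⟨e, s, hs⟩ <;> rcases y with w | ⟨e', t, ht⟩ <;> simp only [interp]
  ring

theorem edgeCoord_ne_of_param_ne {e : Γ.E} {t : ℝ} {y : Γ.Point} (ht : t ∈ Ioo 0 (Γ.len e))
    (h : Γ.param e t ≠ y) : t ≠ edgeCoord e y := by
  rcases y with v | ⟨e', s, hs⟩
  · exact ht.1.ne'
  · by_cases he : e' = e
    · subst he
      simpa [edgeCoord, param_eq_interior_iff] using h
    · simpa [edgeCoord, he] using ht.1.ne'

namespace IsGreen

variable {o : Γ.V} {g : Γ.V → Γ.V → ℝ}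

theorem kernel_comm (hg : Γ.IsGreen o g) (x y : Γ.Point) : kernel g x y = kernel g y x := by
  have htranspose (w : Γ.V) : (fun v => g v w) = g w := funext fun v => hg.symm v w
  simp only [kernel, bump_comm x y, interp_interp_comm g x y, htranspose]

theorem energy_interp (hg : Γ.IsGreen o g) (y : Γ.Point) (F : Γ.V → ℝ) :
    Γ.energy (fun v => interp (g v) y) F = interp F y - F o := by
  rcases y with w | ⟨e, t, ht⟩
  · simp only [interp, fun v => hg.symm v w]
    exact hg.energy_eq w F
  · have hcomb : (fun v => interp (g v) (.interior e t ht)) =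
        g (Γ.src e) + (t / Γ.len e) • (g (Γ.tgt e) - g (Γ.src e)) := by
      ext v
      simp only [interp, hg.symm v, Pi.add_apply, Pi.smul_apply, Pi.sub_apply, smul_eq_mul]
      ring
    rw [hcomb, map_add, map_smul, map_sub, LinearMap.add_apply, LinearMap.smul_apply,
      LinearMap.sub_apply, hg.energy_eq, hg.energy_eq, interp, smul_eq_mul]
    ring

open Classical in
theorem slopeSum_kernel (hg : Γ.IsGreen o g) (hl : ∀ e, 0 < Γ.len e) (x y : Γ.Point) :
    Γ.slopeSum (fun x => kernel g x y) x =
      (if x = .vertex o then 1 else 0) - (if x = y then 1 else 0) := by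
  unfold kernel
  rw [(hasSlopes_interp hl _).slopeSum_add (hasSlopes_bump hl y) hl]
  rcases x with v | ⟨e, t, ht⟩
  · rw [slopeSum_interp_vertex hl, hg.energy_interp, slopeSum_bump_vertex hl]
    simp only [Pi.single_apply, Point.vertex.injEq, eq_comm (a := o)]
    ring
  · rw [slopeSum_interp_interior hl, slopeSum_bump_interior hl]
    simp

theorem isVoltage (hg : Γ.IsGreen o g) (hl : ∀ e, 0 < Γ.len e) (z y : Γ.Point) :
    Γ.IsVoltage z y (fun x => kernelVoltage g z x y) := by
  have hsub := (hasSlopes_kernel hl g y).sub (hasSlopes_kernel hl g z)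
  have hconst := hasSlopes_const (Γ := Γ) (kernel g z z - kernel g z y)
  refine ⟨by simp [kernelVoltage], ?_, fun e t ht hy hz => ?_, fun x => ?_⟩
  · exact ((continuous_kernel hl g y).sub (continuous_kernel hl g z)).add continuous_const
  · refine ⟨_, (hsub.add hconst).hasAffineGerm_nhds ht ?_⟩
    simp only [lt_iff_le_and_ne, edgeCoord_ne_of_param_ne ht hy, edgeCoord_ne_of_param_ne ht hz,
      ne_eq, not_false_eq_true, and_true]
  · unfold kernelVoltage
    rw [hsub.slopeSum_add hconst hl, slopeSum_const _ hl,
      (hasSlopes_kernel hl g y).slopeSum_sub (hasSlopes_kernel hl g z) hl, hg.slopeSum_kernel hl,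
      hg.slopeSum_kernel hl]
    ring

end IsGreen

/-! ### Uniqueness of the voltage function -/

theorem eventually_nhdsNE_param_ne (x : Γ.Point) (e : Γ.E) (t : ℝ) :
    ∀ᶠ s in 𝓝[≠] t, s ∈ Ioo 0 (Γ.len e) → Γ.param e s ≠ x := by
  have hsub : {s | s ∈ Ioo 0 (Γ.len e) ∧ Γ.param e s = x}.Subsingleton := by
    rintro s ⟨-, hs⟩ r ⟨hr, hrx⟩
    rw [← hrx, param_of_mem hr, param_eq_interior_iff] at hs
    exact hs.2
  rw [eventually_nhdsWithin_iff]
  filter_upwards [(hsub.finite.sdiff (t := {t})).isClosed.compl_mem_nhds (by simp)]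
    with s hs hst hmem hx
  exact hs ⟨⟨hmem, hx⟩, hst⟩

theorem IsVoltage.exists_hasSlopes {z y : Γ.Point} {f : Γ.Point → ℝ} (hf : Γ.IsVoltage z y f) :
    ∃ R S, HasSlopes f R S := by
  have hcont (e : Γ.E) : Continuous fun s => f (Γ.param e s) :=
    hf.continuous.comp (continuous_param e)
  have hgerm (e : Γ.E) (t : ℝ) : ∀ᶠ s in 𝓝[≠] t, s ∈ Ioo 0 (Γ.len e) →
      ∃ c, HasAffineGerm (𝓝 s) (fun s => f (Γ.param e s)) s c := by
    filter_upwards [eventually_nhdsNE_param_ne y e t, eventually_nhdsNE_param_ne z e t]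
      with s hy hz hs
    exact hf.locally_affine e s hs (hy hs) (hz hs)
  have hright : ∀ e, ∀ t ∈ Ico 0 (Γ.len e),
      ∃ c, HasAffineGerm (𝓝[≥] t) (fun s => f (Γ.param e s)) t c := fun e t ht => by
    refine exists_hasAffineGerm_nhdsGE (hcont e) ?_
    filter_upwards [(hgerm e t).filter_mono (nhdsGT_le_nhdsNE t), Ioo_mem_nhdsGT ht.2]
      with s hs hst
    exact hs ⟨ht.1.trans_lt hst.1, hst.2⟩
  have hleft : ∀ e, ∀ t ∈ Ioc 0 (Γ.len e),
      ∃ c, HasAffineGerm (𝓝[≤] t) (fun s => f (Γ.param e s)) t c := fun e t ht => by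
    refine exists_hasAffineGerm_nhdsLE (hcont e) ?_
    filter_upwards [(hgerm e t).filter_mono (nhdsLT_le_nhdsNE t), Ioo_mem_nhdsLT ht.1]
      with s hs hst
    exact hs ⟨hst.1, hst.2.trans_le ht.2⟩
  choose! R hR using hright
  choose! S hS using hleft
  exact ⟨R, S, hR, hS⟩

theorem HasSlopes.eq_interp {f : Γ.Point → ℝ} {R S : Γ.E → ℝ → ℝ} (h : HasSlopes f R S)
    (hl : ∀ e, 0 < Γ.len e) (hf : Continuous f)
    (h0 : ∀ e t ht, Γ.slopeSum f (.interior e t ht) = 0) :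
    f = interp fun v => f (.vertex v) := by
  ext x
  obtain ⟨v, rfl⟩ | ⟨e, t, ht, rfl⟩ := vertex_or_exists_param x
  · rfl
  obtain ⟨c, hc⟩ := exists_affineOn_Icc_of_hasAffineGerm
    (hf.comp (continuous_param e)).continuousOn fun t ht => ⟨_, h.hasAffineGerm_nhds ht <| by
      rw [← sub_eq_zero, ← h.slopeSum_interior e t ht, h0]⟩
  have ht' := Ioo_subset_Icc_self ht
  have hleft := hc t ht' 0 (left_mem_Icc.2 (hl e).le)
  have hright := hc (Γ.len e) (right_mem_Icc.2 (hl e).le) 0 (left_mem_Icc.2 (hl e).le)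
  simp only [Function.comp_apply, param_zero, param_len (hl e), sub_zero] at hleft hright
  rw [interp_param ht' (hl e), hleft, hright, add_sub_cancel_left,
    mul_div_cancel_right₀ _ (hl e).ne']

theorem HasSlopes.eq_of_slopeSum_eq_zero {f : Γ.Point → ℝ} {R S : Γ.E → ℝ → ℝ}
    (h : HasSlopes f R S) (hΓ : Γ.IsMetrizedGraph) (hf : Continuous f)
    (h0 : ∀ x, Γ.slopeSum f x = 0) (x y : Γ.Point) : f x = f y := by
  set u : Γ.V → ℝ := fun v => f (.vertex v)
  have hinterp : f = interp u := h.eq_interp hΓ.2 hf fun _ _ _ => h0 _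
  have henergy : Γ.energy u = 0 := by
    classical
    have := Fintype.ofFinite Γ.V
    refine LinearMap.pi_ext' fun v => LinearMap.ext_ring ?_
    have hv := slopeSum_interp_vertex hΓ.2 u v
    rw [← hinterp, h0, zero_eq_neg] at hv
    exact hv
  have hu : ∀ v w, u v = u w := hΓ.eq_of_energy_self_eq_zero (by rw [henergy]; rfl)
  obtain ⟨v₀⟩ := hΓ.1.1
  have hconst : ∀ x, interp u x = u v₀ := fun x => by
    rcases x with v | ⟨e, t, ht⟩
    · exact hu v v₀
    · rw [interp, hu (Γ.tgt e) (Γ.src e), hu (Γ.src e) v₀]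
      ring
  rw [hinterp, hconst, hconst]

theorem IsVoltage.unique (hΓ : Γ.IsMetrizedGraph) {z y : Γ.Point} {f₁ f₂ : Γ.Point → ℝ}
    (h₁ : Γ.IsVoltage z y f₁) (h₂ : Γ.IsVoltage z y f₂) : f₁ = f₂ := by
  obtain ⟨R₁, S₁, hs₁⟩ := h₁.exists_hasSlopes
  obtain ⟨R₂, S₂, hs₂⟩ := h₂.exists_hasSlopes
  have hconst := (hs₁.sub hs₂).eq_of_slopeSum_eq_zero hΓ (h₁.continuous.sub h₂.continuous)
    fun x => by rw [hs₁.slopeSum_sub hs₂ hΓ.2]; linarith [h₁.kirchhoff x, h₂.kirchhoff x]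
  ext x
  have hx := hconst x z
  rwa [h₁.ref_eq_zero, h₂.ref_eq_zero, sub_self, sub_eq_zero] at hx

theorem IsGreen.voltage_eq {o : Γ.V} {g : Γ.V → Γ.V → ℝ} (hg : Γ.IsGreen o g)
    (hΓ : Γ.IsMetrizedGraph) (z x y : Γ.Point) : Γ.voltage z x y = kernelVoltage g z x y := by
  have h := hg.isVoltage hΓ.2 z y
  exact congrFun (IsVoltage.unique hΓ (Classical.epsilon_spec ⟨_, h⟩) h) x

/-! ### Integration against signed measures -/

section SignedMeasure

variable {X Y : Type*} [MeasurableSpace X] [MeasurableSpace Y]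

theorem isFiniteMeasure_variation (ν : SignedMeasure X) : IsFiniteMeasure ν.variation := by
  rw [← ν.totalVariation_eq_variation]
  infer_instance

theorem integrable_signedMeasure_of_bound (ν : SignedMeasure X) {f : X → ℝ} (hf : Measurable f)
    {C : ℝ} (hC : ∀ x, ‖f x‖ ≤ C) : ν.Integrable f := by
  have := isFiniteMeasure_variation ν
  exact Integrable.of_bound (μ := ν.variation) hf.aestronglyMeasurable C (.of_forall hC)

theorem integral_signedMeasure_const (ν : SignedMeasure X) (c : ℝ) :
    ∫ᵛ _, c ∂<•ν = ν univ * c := by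
  have := isFiniteMeasure_variation ν
  simp [VectorMeasure.integral_const]

theorem integral_signedMeasure_eq_sub (ν : SignedMeasure X) {f : X → ℝ} (hf : Measurable f)
    {C : ℝ} (hC : ∀ x, ‖f x‖ ≤ C) :
    ∫ᵛ x, f x ∂<•ν = ∫ x, f x ∂ν.toJordanDecomposition.posPart -
      ∫ x, f x ∂ν.toJordanDecomposition.negPart := by
  conv_lhs => rw [← ν.toSignedMeasure_toJordanDecomposition, JordanDecomposition.toSignedMeasure]
  rw [VectorMeasure.integral_sub_vectorMeasure (integrable_signedMeasure_of_bound _ hf hC)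
    (integrable_signedMeasure_of_bound _ hf hC), VectorMeasure.integral_toSignedMeasure,
    VectorMeasure.integral_toSignedMeasure]

section Swap

variable {f : X → Y → ℝ} {C : ℝ}

theorem integrable_signedMeasure_integral (μ : SignedMeasure X) (ν : Measure Y) [IsFiniteMeasure ν]
    (hf : Measurable (Function.uncurry f)) (hC : ∀ x y, ‖f x y‖ ≤ C) :
    μ.Integrable fun x => ∫ y, f x y ∂ν :=
  integrable_signedMeasure_of_bound μ hf.stronglyMeasurable.integral_prod_right.measurable
    fun x => norm_integral_le_of_norm_le_const (.of_forall (hC x))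

theorem integral_signedMeasure_integral_swap (μ : SignedMeasure X) (ν : Measure Y)
    [IsFiniteMeasure ν] (hf : Measurable (Function.uncurry f)) (hC : ∀ x y, ‖f x y‖ ≤ C) :
    ∫ᵛ x, (∫ y, f x y ∂ν) ∂<•μ = ∫ y, (∫ᵛ x, f x y ∂<•μ) ∂ν := by
  have h_int (m : Measure X) [IsFiniteMeasure m] : Integrable (Function.uncurry f) (m.prod ν) :=
    .of_bound hf.aestronglyMeasurable C (.of_forall fun p => hC p.1 p.2)
  have h_left (y : Y) := integral_signedMeasure_eq_sub μ (f := fun x => f x y)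
    (hf.comp measurable_prodMk_right) fun x => hC x y
  rw [integral_signedMeasure_eq_sub μ hf.stronglyMeasurable.integral_prod_right.measurable
      fun x => norm_integral_le_of_norm_le_const (.of_forall (hC x)),
    integral_integral_swap (h_int _), integral_integral_swap (h_int _)]
  simp only [h_left]
  exact (integral_sub (h_int _).integral_prod_right (h_int _).integral_prod_right).symm

theorem integral_signedMeasure_swap (μ : SignedMeasure X) (ν : SignedMeasure Y)
    (hf : Measurable (Function.uncurry f)) (hC : ∀ x y, ‖f x y‖ ≤ C) :
    ∫ᵛ x, (∫ᵛ y, f x y ∂<•ν) ∂<•μ = ∫ᵛ y, (∫ᵛ x, f x y ∂<•μ) ∂<•ν := by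
  have h_swap : Measurable (Function.uncurry fun y x => f x y) := hf.comp measurable_swap
  have h_right (x : X) := integral_signedMeasure_eq_sub ν (f := f x)
    (hf.comp measurable_prodMk_left) (hC x)
  have h_left (y : Y) := integral_signedMeasure_eq_sub μ (f := fun x => f x y)
    (hf.comp measurable_prodMk_right) fun x => hC x y
  simp only [h_right]
  rw [VectorMeasure.integral_fun_sub (integrable_signedMeasure_integral μ _ hf hC)
      (integrable_signedMeasure_integral μ _ hf hC),
    integral_signedMeasure_integral_swap μ _ hf hC, integral_signedMeasure_integral_swap μ _ hf hC]
  refine (integral_signedMeasure_eq_sub ν (C := C * μ.toJordanDecomposition.posPart.real univ +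
    C * μ.toJordanDecomposition.negPart.real univ) ?_ fun y => ?_).symm
  · simp only [h_left]
    exact h_swap.stronglyMeasurable.integral_prod_right.measurable.sub
      h_swap.stronglyMeasurable.integral_prod_right.measurable
  · rw [h_left]
    exact (norm_sub_le _ _).trans (add_le_add
      (norm_integral_le_of_norm_le_const (.of_forall fun x => hC x y))
      (norm_integral_le_of_norm_le_const (.of_forall fun x => hC x y)))

end Swap

theorem eq_of_integral_signedMeasure_eq_const {μ ν : SignedMeasure X} (hμ : μ univ = 1)
    (hν : ν univ = 1) {f : X → X → ℝ} (hf : Measurable (Function.uncurry f)) {C : ℝ}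
    (hC : ∀ x y, ‖f x y‖ ≤ C) (h_symm : ∀ x y, f x y = f y x) {c d : ℝ}
    (hc : ∀ y, ∫ᵛ x, f x y ∂<•μ = c) (hd : ∀ y, ∫ᵛ x, f x y ∂<•ν = d) : c = d := by
  have h_swap := integral_signedMeasure_swap μ ν hf hC
  simp only [fun x y => h_symm y x] at hd
  simpa [hc, hd, integral_signedMeasure_const, hμ, hν, eq_comm] using h_swap

end SignedMeasure

/-! ### The canonical measure -/

instance (Γ : LengthGraph.{u}) : CompactSpace Γ.Point := by
  have h_cover : (univ : Set Γ.Point) =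
      (⋃ v : Γ.V, {.vertex v}) ∪ ⋃ e : Γ.E, Γ.param e '' Icc 0 (Γ.len e) := by
    refine (eq_univ_of_forall fun x => ?_).symm
    rcases x with v | ⟨e, t, ht⟩
    · exact Or.inl (mem_iUnion.2 ⟨v, rfl⟩)
    · exact Or.inr (mem_iUnion.2 ⟨e, t, ⟨ht.1.le, ht.2.le⟩, param_of_mem ht⟩)
  exact ⟨h_cover ▸ (isCompact_iUnion fun v => isCompact_singleton).union
    (isCompact_iUnion fun e => isCompact_Icc.image (continuous_param e))⟩

theorem integrable_of_continuous (ν : SignedMeasure Γ.Point) {f : Γ.Point → ℝ}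
    (hf : Continuous f) : ν.Integrable f :=
  have ⟨_, hC⟩ := isCompact_univ.exists_bound_of_continuousOn hf.continuousOn
  integrable_signedMeasure_of_bound ν hf.measurable fun x => hC x (mem_univ x)

/-- The constant density of the canonical measure on the edge `e`. -/
noncomputable def edgeDensity (g : Γ.V → Γ.V → ℝ) (e : Γ.E) : ℝ :=
  (Γ.len e - kernelRes g (Γ.src e) (Γ.tgt e)) / Γ.len e ^ 2

/-- Half the slope, from one end of the edge `e` to the other, of the diagonal of `g`. -/
noncomputable def diagSlope (g : Γ.V → Γ.V → ℝ) (e : Γ.E) : ℝ :=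
  (g (Γ.tgt e) (Γ.tgt e) - g (Γ.src e) (Γ.src e)) / (2 * Γ.len e)

/-- The canonical measure `δ_o + Δγ / 2`, where `γ x = kernel g x x` for a Green function `g`
grounded at `o`; on the edge `e`, `γ` is a quadratic polynomial with second derivative
`-2 edgeDensity g e`. -/
noncomputable def canonicalMeasure (o : Γ.V) (g : Γ.V → Γ.V → ℝ) : SignedMeasure Γ.Point :=
  VectorMeasure.dirac (.vertex o) 1 + ∑ e : Γ.E,
    (diagSlope g e • (VectorMeasure.dirac (.vertex (Γ.tgt e)) 1 -
        VectorMeasure.dirac (.vertex (Γ.src e)) 1) +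
      edgeDensity g e •
        (((volume.restrict (Ioc 0 (Γ.len e))).map (Γ.param e)).toSignedMeasure -
          (Γ.len e / 2) • (VectorMeasure.dirac (.vertex (Γ.src e)) 1 +
            VectorMeasure.dirac (.vertex (Γ.tgt e)) 1)))

theorem integral_canonicalMeasure (hl : ∀ e, 0 < Γ.len e) (o : Γ.V) (g : Γ.V → Γ.V → ℝ)
    {f : Γ.Point → ℝ} (hf : Continuous f) :
    ∫ᵛ x, f x ∂<•canonicalMeasure o g = f (.vertex o) + ∑ e : Γ.E,
      (diagSlope g e * (f (.vertex (Γ.tgt e)) - f (.vertex (Γ.src e))) +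
        edgeDensity g e * ((∫ t in (0 : ℝ)..Γ.len e, f (Γ.param e t)) -
          Γ.len e / 2 * (f (.vertex (Γ.src e)) + f (.vertex (Γ.tgt e))))) := by
  have h_int := fun ν : SignedMeasure Γ.Point => integrable_of_continuous ν hf
  have h_meas := hf.measurable.stronglyMeasurable
  have h_edge (e : Γ.E) :
      ∫ᵛ x, f x ∂<•((volume.restrict (Ioc 0 (Γ.len e))).map (Γ.param e)).toSignedMeasure =
        ∫ t in (0 : ℝ)..Γ.len e, f (Γ.param e t) := by
    rw [VectorMeasure.integral_toSignedMeasure,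
      integral_map (continuous_param e).measurable.aemeasurable h_meas.aestronglyMeasurable,
      intervalIntegral.integral_of_le (hl e).le]
  simp [canonicalMeasure, VectorMeasure.integral_add_vectorMeasure, h_int,
    VectorMeasure.integral_finsetSum_vectorMeasure, VectorMeasure.integral_dirac' h_meas,
    VectorMeasure.integral_smul_vectorMeasure, VectorMeasure.integral_sub_vectorMeasure, h_edge,
    mul_add]

theorem canonicalMeasure_univ (hl : ∀ e, 0 < Γ.len e) (o : Γ.V) (g : Γ.V → Γ.V → ℝ) :
    canonicalMeasure o g univ = 1 := by
  rw [← mul_one (canonicalMeasure o g univ), ← integral_signedMeasure_const,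
    integral_canonicalMeasure hl o g continuous_const]
  refine add_eq_left.2 (Finset.sum_eq_zero fun e _ => ?_)
  simp
  ring_nf
  simp

/-- The function `c e * t * (len e - t)` in the coordinate `t` of each edge `e`. -/
noncomputable def hat (c : Γ.E → ℝ) (x : Γ.Point) : ℝ :=
  ∑ e, c e * (edgeCoord e x * (Γ.len e - edgeCoord e x))

theorem hat_vertex (c : Γ.E → ℝ) (v : Γ.V) : hat c (.vertex v) = 0 := by
  simp [hat, edgeCoord]

theorem hat_param {e : Γ.E} {t : ℝ} (ht : t ∈ Icc 0 (Γ.len e)) (he : 0 < Γ.len e)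
    (c : Γ.E → ℝ) : hat c (Γ.param e t) = c e * (t * (Γ.len e - t)) :=
  sum_edgeCoord_param (φ := fun e a => c e * (a * (Γ.len e - a))) (by simp) (by simp) ht he

theorem continuous_hat (hl : ∀ e, 0 < Γ.len e) (c : Γ.E → ℝ) : Continuous (hat c) :=
  continuous_of_forall_continuousOn_edge hl fun e =>
    ContinuousOn.congr (Continuous.continuousOn (by fun_prop)) fun _ ht => hat_param ht (hl e) c

theorem bump_vertex (hl : ∀ e, 0 < Γ.len e) (v : Γ.V) (y : Γ.Point) : bump (.vertex v) y = 0 :=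
  Finset.sum_eq_zero fun e _ => segmentGreen_zero (edgeCoord_mem_Ico hl e y).1

theorem integral_interp_param {e : Γ.E} (he : 0 < Γ.len e) (u : Γ.V → ℝ) :
    ∫ t in (0 : ℝ)..Γ.len e, interp u (Γ.param e t) =
      Γ.len e / 2 * (u (Γ.src e) + u (Γ.tgt e)) := by
  rw [intervalIntegral.integral_congr fun t ht => interp_param (uIcc_of_le he.le ▸ ht) he u,
    intervalIntegral.integral_add (by simp) (Continuous.intervalIntegrable (by fun_prop) _ _),
    intervalIntegral.integral_const, intervalIntegral.integral_const_mul, integral_id]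
  simp only [sub_zero, smul_eq_mul]
  field_simp [he.ne']
  ring

theorem integral_hat_param {e : Γ.E} (he : 0 < Γ.len e) (c : Γ.E → ℝ) :
    ∫ t in (0 : ℝ)..Γ.len e, hat c (Γ.param e t) = c e * Γ.len e ^ 3 / 6 := by
  rw [intervalIntegral.integral_congr (g := fun t => c e * (Γ.len e * t - t ^ 2)) fun t ht => by
      rw [hat_param (uIcc_of_le he.le ▸ ht) he c]; ring,
    intervalIntegral.integral_const_mul, intervalIntegral.integral_sub
      (Continuous.intervalIntegrable (by fun_prop) _ _) (by simp),
    intervalIntegral.integral_const_mul, integral_id, integral_pow]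
  norm_num
  ring

theorem integral_segmentGreen {L a : ℝ} (ha : a ∈ Icc 0 L) :
    ∫ s in (0 : ℝ)..L, segmentGreen L a s = a * (L - a) / 2 := by
  rcases (ha.1.trans ha.2).eq_or_lt with rfl | hL
  · simp [le_antisymm ha.2 ha.1]
  have h_cont : Continuous (segmentGreen L a) := by unfold segmentGreen; fun_prop
  have h_left : ∫ s in (0 : ℝ)..a, segmentGreen L a s = ∫ s in (0 : ℝ)..a, (1 - a / L) * s :=
    intervalIntegral.integral_congr fun s hs => by
      rw [segmentGreen, min_eq_left (uIcc_of_le ha.1 ▸ hs).2]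
      ring
  have h_right : ∫ s in a..L, segmentGreen L a s = ∫ s in a..L, (a - a / L * s) :=
    intervalIntegral.integral_congr fun s hs => by
      rw [segmentGreen, min_eq_right (uIcc_of_le ha.2 ▸ hs).1]
      ring
  rw [← intervalIntegral.integral_add_adjacent_intervals (h_cont.intervalIntegrable 0 a)
    (h_cont.intervalIntegrable a L), h_left, h_right, intervalIntegral.integral_sub (by simp)
    (Continuous.intervalIntegrable (by fun_prop) _ _), intervalIntegral.integral_const_mul,
    intervalIntegral.integral_const_mul, integral_id, integral_id, intervalIntegral.integral_const]
  simp only [smul_eq_mul]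
  field_simp
  ring

theorem integral_canonicalMeasure_interp (hl : ∀ e, 0 < Γ.len e) (o : Γ.V) (g : Γ.V → Γ.V → ℝ)
    (u : Γ.V → ℝ) : ∫ᵛ x, interp u x ∂<•canonicalMeasure o g =
      u o + Γ.energy (fun v => g v v) u / 2 := by
  rw [integral_canonicalMeasure hl o g (continuous_interp hl u), energy_apply, Finset.sum_div]
  congr 1
  refine Finset.sum_congr rfl fun e _ => ?_
  rw [integral_interp_param (hl e)]
  simp only [interp, diagSlope, sub_self, mul_zero, add_zero]
  ring

theorem integral_canonicalMeasure_bump (hl : ∀ e, 0 < Γ.len e) (o : Γ.V) (g : Γ.V → Γ.V → ℝ)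
    (y : Γ.Point) :
    ∫ᵛ x, bump x y ∂<•canonicalMeasure o g = hat (edgeDensity g) y / 2 := by
  have h_edge (e : Γ.E) : ∫ t in (0 : ℝ)..Γ.len e, bump (Γ.param e t) y =
      edgeCoord e y * (Γ.len e - edgeCoord e y) / 2 := by
    rw [intervalIntegral.integral_congr fun t ht => bump_param hl (uIcc_of_le (hl e).le ▸ ht) y,
      integral_segmentGreen (Ico_subset_Icc_self (edgeCoord_mem_Ico hl e y))]
  simp only [integral_canonicalMeasure hl o g (continuous_bump hl y), bump_vertex hl, h_edge, hat,
    Finset.sum_div]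
  simp [mul_div_assoc]

theorem integral_canonicalMeasure_hat (hl : ∀ e, 0 < Γ.len e) (o : Γ.V) (g : Γ.V → Γ.V → ℝ) :
    ∫ᵛ x, hat (edgeDensity g) x ∂<•canonicalMeasure o g =
      ∑ e, (Γ.len e - kernelRes g (Γ.src e) (Γ.tgt e)) ^ 2 / (6 * Γ.len e) := by
  simp only [integral_canonicalMeasure hl o g (continuous_hat hl _), hat_vertex,
    fun e => integral_hat_param (hl e), zero_add, sub_zero, add_zero, mul_zero]
  refine Finset.sum_congr rfl fun e _ => ?_
  have := (hl e).ne'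
  simp only [edgeDensity]
  field_simp

/-! ### The tau constant in terms of a Green function -/

/-- The tau constant expressed by a Green function on the vertices; see `IsGreen.tau_eq`. -/
noncomputable def tauSum (g : Γ.V → Γ.V → ℝ) : ℝ :=
  1 / 4 * ∑ e : Γ.E, ((g (Γ.tgt e) (Γ.tgt e) - g (Γ.src e) (Γ.src e)) ^ 2 / Γ.len e +
    (Γ.len e - kernelRes g (Γ.src e) (Γ.tgt e)) ^ 2 / (3 * Γ.len e))

theorem kernelVoltage_self (g : Γ.V → Γ.V → ℝ) (z x : Γ.Point) :
    kernelVoltage g z x x = kernel g x x - kernel g x z + (kernel g z z - kernel g z x) := rfl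

namespace IsGreen

variable {o : Γ.V} {g : Γ.V → Γ.V → ℝ}

theorem kernel_diag (hg : Γ.IsGreen o g) (hl : ∀ e, 0 < Γ.len e) (x : Γ.Point) :
    kernel g x x = interp (fun v => g v v) x + hat (edgeDensity g) x := by
  obtain ⟨v, rfl⟩ | ⟨e, t, ht, rfl⟩ := vertex_or_exists_param x
  · simp [kernel, interp, bump_vertex hl, hat_vertex]
  · have ht' := Ioo_subset_Icc_self ht
    rw [kernel, bump_param hl ht', edgeCoord_param ht, hat_param ht' (hl e)]
    simp only [interp_param ht' (hl e), segmentGreen, min_self, edgeDensity, kernelRes,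
      hg.symm (Γ.tgt e) (Γ.src e)]
    have := (hl e).ne'
    field_simp
    ring

theorem continuous_kernel_diag (hg : Γ.IsGreen o g) (hl : ∀ e, 0 < Γ.len e) :
    Continuous fun x => kernel g x x := by
  simp only [hg.kernel_diag hl]
  exact (continuous_interp hl _).add (continuous_hat hl _)

theorem integral_canonicalMeasure_kernel (hg : Γ.IsGreen o g) (hl : ∀ e, 0 < Γ.len e)
    (y : Γ.Point) : ∫ᵛ x, kernel g x y ∂<•canonicalMeasure o g = kernel g y y / 2 := by
  have h_ground : interp (g o) y = 0 := by
    rcases y with v | ⟨e, t, ht⟩ <;> simp [interp, hg.ground_left]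
  simp only [kernel]
  rw [VectorMeasure.integral_fun_add (integrable_of_continuous _ (continuous_interp hl _))
      (integrable_of_continuous _ (continuous_bump hl y)),
    integral_canonicalMeasure_interp hl, integral_canonicalMeasure_bump hl, energy_comm,
    hg.energy_interp, ← kernel, hg.kernel_diag hl, h_ground, hg.ground]
  ring

theorem integral_canonicalMeasure_kernel_diag (hg : Γ.IsGreen o g) (hl : ∀ e, 0 < Γ.len e) :
    ∫ᵛ x, kernel g x x ∂<•canonicalMeasure o g = 2 * tauSum g := by
  simp only [hg.kernel_diag hl]
  rw [VectorMeasure.integral_fun_add (integrable_of_continuous _ (continuous_interp hl _))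
      (integrable_of_continuous _ (continuous_hat hl _)),
    integral_canonicalMeasure_interp hl, integral_canonicalMeasure_hat hl, hg.ground, energy_apply,
    tauSum, zero_add, Finset.sum_div, ← Finset.sum_add_distrib, Finset.mul_sum, Finset.mul_sum]
  refine Finset.sum_congr rfl fun e _ => ?_
  ring

theorem integral_canonicalMeasure_kernelVoltage (hg : Γ.IsGreen o g) (hl : ∀ e, 0 < Γ.len e)
    (x : Γ.Point) :
    ∫ᵛ z, kernelVoltage g z x x ∂<•canonicalMeasure o g = 2 * tauSum g := by
  have h_kernel := integrable_of_continuous (canonicalMeasure o g) (continuous_kernel hl g x)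
  have h_diag := integrable_of_continuous (canonicalMeasure o g) (hg.continuous_kernel_diag hl)
  have h_const := integrable_of_continuous (canonicalMeasure o g)
    (continuous_const (y := kernel g x x))
  simp only [kernelVoltage_self, hg.kernel_comm x]
  rw [VectorMeasure.integral_fun_add (h_const.fun_sub h_kernel) (h_diag.fun_sub h_kernel),
    VectorMeasure.integral_fun_sub h_const h_kernel, VectorMeasure.integral_fun_sub h_diag h_kernel,
    integral_signedMeasure_const, canonicalMeasure_univ hl,
    hg.integral_canonicalMeasure_kernel hl, hg.integral_canonicalMeasure_kernel_diag hl]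
  ring

end IsGreen

theorem measurable_edgeCoord (hl : ∀ e, 0 < Γ.len e) (e : Γ.E) : Measurable (edgeCoord e) := by
  refine measurable_of_Ioi fun c => ?_
  rcases lt_or_ge c 0 with hc | hc
  · rw [eq_univ_of_forall (s := edgeCoord e ⁻¹' Ioi c)
      fun x => hc.trans_le (edgeCoord_mem_Ico hl e x).1]
    exact .univ
  suffices h : IsOpen (edgeCoord e ⁻¹' Ioi c) from h.measurableSet
  refine isOpen_iSup_iff.2 fun e' => ?_
  by_cases he : e' = e
  · subst he
    suffices h : Γ.param e' ⁻¹' (edgeCoord e' ⁻¹' Ioi c) = Ioo c (Γ.len e') from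
      isOpen_coinduced.2 (h ▸ isOpen_Ioo)
    ext t
    by_cases ht : t ∈ Ioo 0 (Γ.len e')
    · simp [edgeCoord_param ht, ht.2]
    · have h_vertex : edgeCoord e' (Γ.param e' t) = 0 := by
        unfold param
        split_ifs <;> rfl
      have h_Ioo : t ∉ Ioo c (Γ.len e') := fun h => ht ⟨hc.trans_lt h.1, h.2⟩
      simp only [mem_preimage, h_vertex, mem_Ioi, hc.not_gt, h_Ioo]
  · suffices h : Γ.param e' ⁻¹' (edgeCoord e ⁻¹' Ioi c) = ∅ from
      isOpen_coinduced.2 (h ▸ isOpen_empty)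
    ext t
    simp [edgeCoord_param_of_ne he, hc]

open Classical in
theorem interp_eq_sum [Fintype Γ.V] (u : Γ.V → ℝ) (x : Γ.Point) :
    interp u x = ∑ v, u v * interp (Pi.single v 1) x := by
  rcases x with v | ⟨e, t, ht⟩
  · simp [interp, Pi.single_apply]
  · simp only [interp, mul_add, sub_div, sub_mul, mul_sub, Finset.sum_add_distrib,
      Finset.sum_sub_distrib, Pi.single_apply, ite_div, ite_mul, mul_ite, zero_div, zero_mul,
      mul_zero, Finset.sum_ite_eq, Finset.mem_univ, if_true]
    ring

theorem measurable_interp {α : Type*} [MeasurableSpace α] (hl : ∀ e, 0 < Γ.len e)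
    {u : α → Γ.V → ℝ} (hu : Measurable u) :
    Measurable fun p : Γ.Point × α => interp (u p.2) p.1 := by
  classical
  have := Fintype.ofFinite Γ.V
  simp only [interp_eq_sum (u _)]
  exact Finset.measurable_sum _ fun v _ =>
    ((measurable_pi_apply v).comp (hu.comp measurable_snd)).mul
      ((continuous_interp hl _).measurable.comp measurable_fst)

theorem measurable_uncurry_kernel (hl : ∀ e, 0 < Γ.len e) (g : Γ.V → Γ.V → ℝ) :
    Measurable (Function.uncurry (kernel g)) := by
  refine (measurable_interp hl (u := fun y v => interp (g v) y)
    (measurable_pi_lambda _ fun v => (continuous_interp hl _).measurable)).add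
    (Finset.measurable_sum _ fun e _ => ?_)
  have h_fst : Measurable fun p : Γ.Point × Γ.Point => edgeCoord e p.1 :=
    (measurable_edgeCoord hl e).comp measurable_fst
  have h_snd : Measurable fun p : Γ.Point × Γ.Point => edgeCoord e p.2 :=
    (measurable_edgeCoord hl e).comp measurable_snd
  exact (h_fst.min h_snd).sub ((h_fst.mul h_snd).div_const _)

theorem abs_interp_le (hl : ∀ e, 0 < Γ.len e) {u : Γ.V → ℝ} {B : ℝ} (hu : ∀ v, |u v| ≤ B)
    (x : Γ.Point) : |interp u x| ≤ B := by
  rcases x with v | ⟨e, t, ht⟩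
  · exact hu v
  · have h_ratio : t / Γ.len e ∈ Icc (0 : ℝ) 1 :=
      ⟨div_nonneg ht.1.le (hl e).le, (div_le_one (hl e)).2 ht.2.le⟩
    have h_convex := (convex_Icc (-B) B).add_smul_sub_mem (abs_le.1 (hu (Γ.src e)))
      (abs_le.1 (hu (Γ.tgt e))) h_ratio
    rw [smul_eq_mul, div_mul_comm] at h_convex
    exact abs_le.2 h_convex

theorem abs_segmentGreen_le {L a s : ℝ} (ha : a ∈ Icc 0 L) (hs : s ∈ Icc 0 L) :
    |segmentGreen L a s| ≤ L := by
  have hL := ha.1.trans ha.2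
  have h_div : s * a / L ≤ L := div_le_of_le_mul₀ hL hL (mul_le_mul hs.2 ha.2 ha.1 hL)
  have h_div_nonneg : 0 ≤ s * a / L := div_nonneg (mul_nonneg hs.1 ha.1) hL
  have h_min : 0 ≤ min s a := le_min hs.1 ha.1
  have h_min_le : min s a ≤ L := (min_le_left s a).trans hs.2
  rw [segmentGreen, abs_le]
  constructor <;> linarith

theorem abs_bump_le (hl : ∀ e, 0 < Γ.len e) (x y : Γ.Point) : |bump x y| ≤ Γ.totalLength :=
  (Finset.abs_sum_le_sum_abs _ _).trans <| Finset.sum_le_sum fun e _ =>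
    abs_segmentGreen_le (Ico_subset_Icc_self (edgeCoord_mem_Ico hl e y))
      (Ico_subset_Icc_self (edgeCoord_mem_Ico hl e x))

theorem exists_abs_kernel_le (hl : ∀ e, 0 < Γ.len e) (g : Γ.V → Γ.V → ℝ) :
    ∃ C, ∀ x y, |kernel g x y| ≤ C := by
  obtain ⟨B, hB⟩ := (Set.finite_range fun p : Γ.V × Γ.V => |g p.1 p.2|).bddAbove
  exact ⟨B + Γ.totalLength, fun x y => (abs_add_le _ _).trans (add_le_add
    (abs_interp_le hl (fun v => abs_interp_le hl (fun w => hB ⟨(v, w), rfl⟩) y) x)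
    (abs_bump_le hl x y))⟩

theorem IsMetrizedGraph.eq_of_voltageMeasure_eq_const (hΓ : Γ.IsMetrizedGraph)
    {μ ν : SignedMeasure Γ.Point} (hμ : μ univ = 1) (hν : ν univ = 1) {c d : ℝ}
    (hc : ∀ x, Γ.voltageMeasure μ x x = c) (hd : ∀ x, Γ.voltageMeasure ν x x = d) : c = d := by
  obtain ⟨o⟩ := hΓ.1.1
  obtain ⟨g, hg⟩ := hΓ.exists_isGreen o
  have h_kernel := measurable_uncurry_kernel hΓ.2 g
  obtain ⟨C, hC⟩ := exists_abs_kernel_le hΓ.2 g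
  refine eq_of_integral_signedMeasure_eq_const hμ hν (f := fun z x => kernelVoltage g z x x)
    (C := C + C + (C + C)) ?_ ?_ ?_ (fun x => ?_) fun x => ?_
  · have h (a b : Γ.Point × Γ.Point → Γ.Point) (ha : Measurable a) (hb : Measurable b) :
      Measurable fun p => kernel g (a p) (b p) := h_kernel.comp (ha.prodMk hb)
    exact ((h _ _ measurable_snd measurable_snd).sub (h _ _ measurable_snd measurable_fst)).add
      ((h _ _ measurable_fst measurable_fst).sub (h _ _ measurable_fst measurable_snd))
  · exact fun z x => (norm_add_le _ _).trans (add_le_add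
      ((norm_sub_le _ _).trans (add_le_add (hC x x) (hC x z)))
      ((norm_sub_le _ _).trans (add_le_add (hC z z) (hC z x))))
  · exact fun z x => by rw [kernelVoltage_self, kernelVoltage_self]; ring
  · simpa only [voltageMeasure, hg.voltage_eq hΓ] using hc x
  · simpa only [voltageMeasure, hg.voltage_eq hΓ] using hd x

theorem IsGreen.tau_eq {o : Γ.V} {g : Γ.V → Γ.V → ℝ} (hg : Γ.IsGreen o g)
    (hΓ : Γ.IsMetrizedGraph) : Γ.tau = tauSum g := by
  have h_univ := canonicalMeasure_univ hΓ.2 o g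
  have h_const (x : Γ.Point) : Γ.voltageMeasure (canonicalMeasure o g) x x = 2 * tauSum g := by
    simpa only [voltageMeasure, hg.voltage_eq hΓ] using
      hg.integral_canonicalMeasure_kernelVoltage hΓ.2 x
  have h_exists : ∃ t : ℝ, ∃ μ : SignedMeasure Γ.Point,
      Γ.IsCanonicalMeasure μ ∧ ∀ x, 1 / 2 * Γ.voltageMeasure μ x x = t :=
    ⟨_, _, ⟨h_univ, _, h_const⟩, fun x => by rw [h_const]⟩
  obtain ⟨μ, ⟨h_mass, c, hc⟩, h_half⟩ := Classical.epsilon_spec h_exists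
  have h_eq := hΓ.eq_of_voltageMeasure_eq_const h_mass h_univ hc h_const
  rw [tau, ← h_half (.vertex o), hc, h_eq]
  ring

/-! ### Resistances and the constant `A` in terms of a Green function -/

theorem kernel_vertex_left (hl : ∀ e, 0 < Γ.len e) (g : Γ.V → Γ.V → ℝ) (v : Γ.V) (y : Γ.Point) :
    kernel g (.vertex v) y = interp (g v) y := by
  rw [kernel, bump_vertex hl, add_zero, interp]

theorem deriv_interp_param {e : Γ.E} (u : Γ.V → ℝ) {t : ℝ} (ht : t ∈ Ioo 0 (Γ.len e)) :
    deriv (fun s => interp u (Γ.param e s)) t = (u (Γ.tgt e) - u (Γ.src e)) / Γ.len e := by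
  have h_affine : (fun s => interp u (Γ.param e s)) =ᶠ[𝓝 t]
      fun s => u (Γ.src e) + (u (Γ.tgt e) - u (Γ.src e)) / Γ.len e * s := by
    filter_upwards [Ioo_mem_nhds ht.1 ht.2] with s hs
    exact interp_param (Ioo_subset_Icc_self hs) (ht.1.trans ht.2) u
  rw [h_affine.deriv_eq]
  simp

namespace IsGreen

variable {o : Γ.V} {g : Γ.V → Γ.V → ℝ}

theorem kernelRes_ground_left (hg : Γ.IsGreen o g) (y : Γ.V) :
    kernelRes g o y = g y y := by
  rw [kernelRes, hg.ground, hg.ground_left]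
  ring

theorem resistance_vertex (hg : Γ.IsGreen o g) (hΓ : Γ.IsMetrizedGraph) (x y : Γ.V) :
    Γ.resistance (.vertex x) (.vertex y) = kernelRes g x y := by
  rw [resistance, hg.voltage_eq hΓ]
  simp only [kernelVoltage, kernel_vertex_left hΓ.2, interp, kernelRes, hg.symm y x]
  ring

theorem resistance_ground (hg : Γ.IsGreen o g) (hΓ : Γ.IsMetrizedGraph) (y : Γ.V) :
    Γ.resistance (.vertex o) (.vertex y) = g y y := by
  rw [hg.resistance_vertex hΓ, hg.kernelRes_ground_left]

theorem kernel_ground_left (hg : Γ.IsGreen o g) (hl : ∀ e, 0 < Γ.len e) (y : Γ.Point) :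
    kernel g (.vertex o) y = 0 := by
  rw [kernel_vertex_left hl]
  rcases y with v | ⟨e, t, ht⟩ <;> simp [interp, hg.ground_left]

theorem voltage_ground_left (hg : Γ.IsGreen o g) (hΓ : Γ.IsMetrizedGraph) (q : Γ.V)
    (x : Γ.Point) : Γ.voltage (.vertex o) x (.vertex q) = interp (g q) x := by
  rw [hg.voltage_eq hΓ, kernelVoltage, hg.kernel_comm x, hg.kernel_comm x,
    kernel_vertex_left hΓ.2 g q]
  simp only [hg.kernel_ground_left hΓ.2, sub_self, sub_zero, add_zero]

theorem voltage_ground_middle (hg : Γ.IsGreen o g) (hΓ : Γ.IsMetrizedGraph) (q : Γ.V)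
    (x : Γ.Point) : Γ.voltage x (.vertex o) (.vertex q) =
      interp (fun v => g v v) x + hat (edgeDensity g) x - interp (g q) x := by
  rw [hg.voltage_eq hΓ, kernelVoltage, hg.kernel_comm x (.vertex q), kernel_vertex_left hΓ.2 g q,
    hg.kernel_ground_left hΓ.2, hg.kernel_ground_left hΓ.2, hg.kernel_diag hΓ.2]
  ring

theorem A_eq (hg : Γ.IsGreen o g) (hΓ : Γ.IsMetrizedGraph) (q : Γ.V) :
    Γ.A (.vertex o) (.vertex q) =
      ∑ e : Γ.E, (g q (Γ.tgt e) - g q (Γ.src e)) ^ 2 / Γ.len e *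
        ((g (Γ.src e) (Γ.src e) - g q (Γ.src e) + (g (Γ.tgt e) (Γ.tgt e) - g q (Γ.tgt e))) / 2 +
          (Γ.len e - kernelRes g (Γ.src e) (Γ.tgt e)) / 6) := by
  have hl := hΓ.2
  refine Finset.sum_congr rfl fun e _ => ?_
  have h_interp (u : Γ.V → ℝ) :
      IntervalIntegrable (fun t => interp u (Γ.param e t)) volume 0 (Γ.len e) :=
    ((continuous_interp hl u).comp (continuous_param e)).intervalIntegrable _ _
  have h_hat : IntervalIntegrable (fun t => hat (edgeDensity g) (Γ.param e t)) volume 0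
      (Γ.len e) := ((continuous_hat hl _).comp (continuous_param e)).intervalIntegrable _ _
  simp only [hg.voltage_ground_middle hΓ, hg.voltage_ground_left hΓ]
  rw [intervalIntegral.integral_congr_Ioo_of_le (hl e).le fun t ht =>
      congrArg (_ * · ^ 2) (deriv_interp_param (g q) ht),
    intervalIntegral.integral_mul_const,
    intervalIntegral.integral_sub ((h_interp _).add h_hat) (h_interp _),
    intervalIntegral.integral_add (h_interp _) h_hat, integral_interp_param (hl e),
    integral_interp_param (hl e), integral_hat_param (hl e), edgeDensity]
  have := (hl e).ne'
  field_simp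
  ring

end IsGreen

/-! ### The resistance of an edge -/

open Classical in
theorem energy_eq_add_deleteEdge (e : Γ.E) (F H : Γ.V → ℝ) :
    Γ.energy F H = (F (Γ.tgt e) - F (Γ.src e)) * (H (Γ.tgt e) - H (Γ.src e)) / Γ.len e +
      (Γ.deleteEdge e).energy F H := by
  rw [energy_apply, energy_apply (Γ := Γ.deleteEdge e) F H,
    ← Finset.add_sum_erase _ _ (Finset.mem_univ e)]
  congr 1
  exact Finset.sum_subtype (p := fun e' => e' ≠ e) _ (by simp)
    (fun e' => (F (Γ.tgt e') - F (Γ.src e')) * (H (Γ.tgt e') - H (Γ.src e')) / Γ.len e')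

theorem connected_deleteEdge (hΓ : Γ.Connected) (e : Γ.E)
    (h : Relation.EqvGen (Γ.deleteEdge e).EdgeRel (Γ.src e) (Γ.tgt e)) :
    (Γ.deleteEdge e).Connected := by
  refine ⟨hΓ.1, fun u v => ?_⟩
  induction hΓ.2 u v with
  | rel x y hxy =>
    obtain ⟨e', rfl, rfl⟩ := hxy
    by_cases he : e' = e
    · exact he ▸ h
    · exact .rel _ _ ⟨⟨e', he⟩, rfl, rfl⟩
  | refl x => exact .refl _
  | symm x y _ ih => exact .symm _ _ ih
  | trans x y z _ _ ih₁ ih₂ => exact .trans _ _ _ ih₁ ih₂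

open Classical in
/-- Kirchhoff's law across a bridge: test the potential against the indicator function of one of
the two components of `Γ - e`. -/
theorem IsGreen.apply_tgt_of_not_connected {g : Γ.V → Γ.V → ℝ} {e : Γ.E}
    (hg : Γ.IsGreen (Γ.src e) g) (hΓ : Γ.Connected) (he : Γ.len e ≠ 0)
    (hc : ¬ (Γ.deleteEdge e).Connected) : g (Γ.tgt e) (Γ.tgt e) = Γ.len e := by
  let F (v : Γ.V) : ℝ :=
    if Relation.EqvGen (Γ.deleteEdge e).EdgeRel (Γ.src e) v then 0 else 1
  have h_src : F (Γ.src e) = 0 := if_pos (.refl _)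
  have h_tgt : F (Γ.tgt e) = 1 := if_neg fun h => hc (connected_deleteEdge hΓ e h)
  have h_edge (e' : (Γ.deleteEdge e).E) :
      F ((Γ.deleteEdge e).tgt e') = F ((Γ.deleteEdge e).src e') := by
    have h_rel : Relation.EqvGen (Γ.deleteEdge e).EdgeRel _ _ := .rel _ _ ⟨e', rfl, rfl⟩
    exact if_congr ⟨fun h => .trans _ _ _ h (.symm _ _ h_rel), fun h => .trans _ _ _ h h_rel⟩
      rfl rfl
  have h_zero : (Γ.deleteEdge e).energy (g (Γ.tgt e)) F = 0 :=
    (energy_apply (Γ := Γ.deleteEdge e) _ _).trans <| Finset.sum_eq_zero fun e' _ => by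
      rw [h_edge, sub_self, mul_zero, zero_div]
  have h_energy := hg.energy_eq (Γ.tgt e) F
  rw [energy_eq_add_deleteEdge e, h_zero, h_src, h_tgt, hg.ground] at h_energy
  field_simp at h_energy
  linarith

/-- The parallel law: the conductance between the end points of `e` is that of `Γ - e` plus
`1 / L_e`. -/
theorem IsGreen.apply_tgt_mul_len_add {g k : Γ.V → Γ.V → ℝ} {e : Γ.E}
    (hg : Γ.IsGreen (Γ.src e) g) (hk : (Γ.deleteEdge e).IsGreen (Γ.src e) k)
    (he : Γ.len e ≠ 0) :
    g (Γ.tgt e) (Γ.tgt e) * (Γ.len e + k (Γ.tgt e) (Γ.tgt e)) =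
      Γ.len e * k (Γ.tgt e) (Γ.tgt e) := by
  have h_energy := hg.energy_eq (Γ.tgt e) (k (Γ.tgt e))
  have h_delete := (energy_comm (Γ := Γ.deleteEdge e) _ _).trans
    (hk.energy_eq (Γ.tgt e) (g (Γ.tgt e)))
  have h_ground : k (Γ.tgt e) (Γ.src e) = 0 := hk.ground _
  rw [energy_eq_add_deleteEdge e, h_delete, hg.ground, h_ground] at h_energy
  field_simp at h_energy
  linarith

theorem invLenAddRes_of_connected {e : Γ.E} (he : 0 < Γ.len e)
    (hc : (Γ.deleteEdge e).Connected)
    (hR : 0 ≤ (Γ.deleteEdge e).resistance (.vertex (Γ.src e)) (.vertex (Γ.tgt e))) :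
    Γ.invLenAddRes e =
      (Γ.len e + (Γ.deleteEdge e).resistance (.vertex (Γ.src e)) (.vertex (Γ.tgt e)))⁻¹ := by
  rw [invLenAddRes, edgeResistance, if_pos hc, ← ENNReal.ofReal_add he.le hR,
    ENNReal.toReal_inv, ENNReal.toReal_ofReal (by positivity)]

theorem invLenAddRes_of_not_connected {e : Γ.E} (hc : ¬ (Γ.deleteEdge e).Connected) :
    Γ.invLenAddRes e = 0 := by
  simp [invLenAddRes, edgeResistance, hc]

theorem IsMetrizedGraph.len_sq_mul_invLenAddRes (hΓ : Γ.IsMetrizedGraph) (e : Γ.E) :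
    Γ.len e ^ 2 * Γ.invLenAddRes e =
      Γ.len e - Γ.resistance (.vertex (Γ.src e)) (.vertex (Γ.tgt e)) := by
  obtain ⟨g, hg⟩ := hΓ.exists_isGreen (Γ.src e)
  have he := hΓ.2 e
  rw [hg.resistance_ground hΓ]
  by_cases hc : (Γ.deleteEdge e).Connected
  · have hΔ : (Γ.deleteEdge e).IsMetrizedGraph := ⟨hc, fun e' => hΓ.2 e'.1⟩
    obtain ⟨k, hk⟩ := hΔ.exists_isGreen (Γ.src e)
    have h_parallel := hg.apply_tgt_mul_len_add hk he.ne'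
    have h_res : (Γ.deleteEdge e).resistance (.vertex (Γ.src e)) (.vertex (Γ.tgt e)) =
      k (Γ.tgt e) (Γ.tgt e) := hk.resistance_ground hΔ _
    have h_nonneg : 0 ≤ k (Γ.tgt e) (Γ.tgt e) := hk.diag_nonneg hΔ.2 _
    rw [invLenAddRes_of_connected he hc (h_res ▸ h_nonneg), h_res]
    have h_ne : Γ.len e + k (Γ.tgt e) (Γ.tgt e) ≠ 0 := by positivity
    field_simp
    linarith
  · rw [invLenAddRes_of_not_connected hc, hg.apply_tgt_of_not_connected hΓ.1 he.ne' hc, mul_zero,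
      sub_self]

/-! ### Scaling -/

theorem totalLength_scale (Γ : LengthGraph.{u}) (c : ℝ) :
    (Γ.scale c).totalLength = c * Γ.totalLength :=
  (Finset.mul_sum _ _ _).symm

theorem IsMetrizedGraph.scale (hΓ : Γ.IsMetrizedGraph) {c : ℝ} (hc : 0 < c) :
    (Γ.scale c).IsMetrizedGraph :=
  ⟨hΓ.1, fun e => mul_pos hc (hΓ.2 e)⟩

theorem IsMetrizedGraph.isNormalized_normalization (hΓ : Γ.IsMetrizedGraph)
    (hℓ : 0 < Γ.totalLength) : Γ.normalization.IsNormalized :=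
  ⟨hΓ.scale (one_div_pos.2 hℓ), by
    rw [normalization, totalLength_scale, one_div_mul_cancel hℓ.ne']⟩

theorem energy_scale (c : ℝ) (F H : Γ.V → ℝ) :
    (Γ.scale c).energy F H = c⁻¹ * Γ.energy F H := by
  rw [energy_apply (Γ := Γ.scale c) F H, energy_apply, Finset.mul_sum]
  refine Finset.sum_congr rfl fun e _ => ?_
  simp only [scale]
  rw [mul_comm c, ← div_div, div_eq_inv_mul _ c]

theorem IsGreen.scale {o : Γ.V} {g : Γ.V → Γ.V → ℝ} (hg : Γ.IsGreen o g) {c : ℝ} (hc : c ≠ 0) :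
    (Γ.scale c).IsGreen o (c • g) where
  ground (y : Γ.V) := by
    change c * g y o = 0
    rw [hg.ground, mul_zero]
  energy_eq (y : Γ.V) (F : Γ.V → ℝ) := calc
    (Γ.scale c).energy (c • g y) F = c⁻¹ * Γ.energy (c • g y) F := energy_scale c _ F
    _ = F y - F o := by
      rw [map_smul, LinearMap.smul_apply, hg.energy_eq, smul_eq_mul, inv_mul_cancel_left₀ hc]

theorem kernelRes_smul {α : Type*} (c : ℝ) (g : α → α → ℝ) (x y : α) :
    kernelRes (c • g) x y = c * kernelRes g x y := by
  simp only [kernelRes, Pi.smul_apply, smul_eq_mul]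
  ring

namespace IsMetrizedGraph

theorem resistance_scale (hΓ : Γ.IsMetrizedGraph) {c : ℝ} (hc : 0 < c) (x y : Γ.V) :
    (Γ.scale c).resistance (.vertex x) (.vertex y) = c * Γ.resistance (.vertex x) (.vertex y) := by
  obtain ⟨g, hg⟩ := hΓ.exists_isGreen x
  exact ((hg.scale hc.ne').resistance_vertex (hΓ.scale hc) x y).trans <|
    (kernelRes_smul c g x y).trans (congrArg (c * ·) (hg.resistance_vertex hΓ x y).symm)

theorem tau_scale (hΓ : Γ.IsMetrizedGraph) {c : ℝ} (hc : 0 < c) :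
    (Γ.scale c).tau = c * Γ.tau := by
  obtain ⟨o⟩ := hΓ.1.1
  obtain ⟨g, hg⟩ := hΓ.exists_isGreen o
  rw [(hg.scale hc.ne').tau_eq (hΓ.scale hc), hg.tau_eq hΓ]
  unfold tauSum
  simp only [Finset.mul_sum]
  refine Finset.sum_congr rfl fun (e : Γ.E) _ => ?_
  have he := (hΓ.2 e).ne'
  simp only [LengthGraph.scale, kernelRes_smul, Pi.smul_apply, smul_eq_mul]
  field_simp

theorem A_scale (hΓ : Γ.IsMetrizedGraph) {c : ℝ} (hc : 0 < c) (p q : Γ.V) :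
    (Γ.scale c).A (.vertex p) (.vertex q) = c ^ 2 * Γ.A (.vertex p) (.vertex q) := by
  obtain ⟨g, hg⟩ := hΓ.exists_isGreen p
  rw [hg.A_eq hΓ, Finset.mul_sum]
  refine ((hg.scale hc.ne').A_eq (hΓ.scale hc) q).trans (Finset.sum_congr rfl fun e _ => ?_)
  have he := (hΓ.2 e).ne'
  simp only [LengthGraph.scale, kernelRes_smul, Pi.smul_apply, smul_eq_mul]
  field_simp

end IsMetrizedGraph

/-! ### The potential between two vertices -/

/-- The function on the vertices that is harmonic off the ground and `q`, with value `0` at the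
ground and `1` at `q`. -/
noncomputable def unitPotential (g : Γ.V → Γ.V → ℝ) (q : Γ.V) : Γ.V → ℝ := (g q q)⁻¹ • g q

theorem unitPotential_self {g : Γ.V → Γ.V → ℝ} {q : Γ.V} (hq : g q q ≠ 0) :
    unitPotential g q q = 1 :=
  inv_mul_cancel₀ hq

theorem mul_unitPotential {g : Γ.V → Γ.V → ℝ} {q : Γ.V} (hq : g q q ≠ 0) (x : Γ.V) :
    g q q * unitPotential g q x = g q x :=
  mul_inv_cancel_left₀ hq _

namespace IsGreen

variable {o q : Γ.V} {g : Γ.V → Γ.V → ℝ}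

theorem unitPotential_ground (hg : Γ.IsGreen o g) : unitPotential g q o = 0 := by
  rw [unitPotential, Pi.smul_apply, hg.ground, smul_zero]

theorem energy_unitPotential (hg : Γ.IsGreen o g) (F : Γ.V → ℝ) :
    Γ.energy (unitPotential g q) F = (F q - F o) / g q q := by
  rw [unitPotential, map_smul, LinearMap.smul_apply, hg.energy_eq, smul_eq_mul, inv_mul_eq_div]

/-- Test `h = unitPotential g q` against `P ∘ h`, where `P' = (1 - 2 h)²`. -/
theorem energy_unitPotential_parabola (hg : Γ.IsGreen o g) (hq : g q q ≠ 0) :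
    Γ.energy (unitPotential g q * (1 - unitPotential g q))
        (unitPotential g q * (1 - unitPotential g q)) +
      (∑ e, (unitPotential g q (Γ.tgt e) - unitPotential g q (Γ.src e)) ^ 4 / Γ.len e) / 3 =
      1 / (3 * g q q) := by
  have h_test := hg.energy_unitPotential (q := q) fun v => unitPotential g q v -
    2 * unitPotential g q v ^ 2 + 4 / 3 * unitPotential g q v ^ 3
  rw [hg.unitPotential_ground, unitPotential_self hq, energy_apply] at h_test
  calc
    _ = _ := by
      rw [energy_apply, Finset.sum_div, ← Finset.sum_add_distrib]
      refine Finset.sum_congr rfl fun e _ => ?_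
      simp only [Pi.mul_apply, Pi.sub_apply, Pi.one_apply]
      ring
    _ = _ := h_test
    _ = _ := by field_simp; norm_num

/-- Test `h = unitPotential g q` against `(1 - 2 h) ψ`. -/
theorem energy_parabola_of_eq_zero (hg : Γ.IsGreen o g) {ψ : Γ.V → ℝ} (ho : ψ o = 0)
    (hψ : ψ q = 0) :
    Γ.energy (unitPotential g q * (1 - unitPotential g q)) ψ =
      ∑ e, (unitPotential g q (Γ.tgt e) - unitPotential g q (Γ.src e)) ^ 2 / Γ.len e *
        (ψ (Γ.src e) + ψ (Γ.tgt e)) := by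
  have h_test := hg.energy_unitPotential (q := q) fun v => (1 - 2 * unitPotential g q v) * ψ v
  rw [ho, hψ, mul_zero, mul_zero, sub_zero, zero_div, energy_apply] at h_test
  rw [← sub_eq_zero, ← h_test, energy_apply, ← Finset.sum_sub_distrib]
  refine Finset.sum_congr rfl fun e _ => ?_
  simp only [Pi.mul_apply, Pi.sub_apply, Pi.one_apply]
  ring

theorem energy_diag_sub (hg : Γ.IsGreen o g) :
    Γ.energy ((fun v => g v v) - g q) ((fun v => g v v) - g q) =
      Γ.energy (fun v => g v v) (fun v => g v v) - g q q := by
  simp only [map_sub, LinearMap.sub_apply, energy_comm _ (g q), hg.energy_eq, hg.ground]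
  ring

/-- The square of the energy norm of the diagonal of the Green function of the graph obtained by
replacing an edge of length `g q q` by `Γ`; see `IsEdgeReplacement.green_diag`. -/
theorem energy_replacement_diag (hg : Γ.IsGreen o g) (hq : g q q ≠ 0) (a b κ : ℝ) {φ : Γ.V → ℝ}
    (hφ : ∀ x, φ x = a + (b - a) * unitPotential g q x +
      κ * (unitPotential g q x * (1 - unitPotential g q x)) + (g x x - g q x)) :
    Γ.energy φ φ = (b - a) ^ 2 / g q q +
      κ ^ 2 * Γ.energy (unitPotential g q * (1 - unitPotential g q))
        (unitPotential g q * (1 - unitPotential g q)) +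
      2 * κ * (∑ e, (unitPotential g q (Γ.tgt e) - unitPotential g q (Γ.src e)) ^ 2 / Γ.len e *
        (g (Γ.src e) (Γ.src e) - g q (Γ.src e) + (g (Γ.tgt e) (Γ.tgt e) - g q (Γ.tgt e)))) +
      (Γ.energy (fun v => g v v) (fun v => g v v) - g q q) := by
  set h := unitPotential g q with h_def
  set ψ : Γ.V → ℝ := (fun v => g v v) - g q with ψ_def
  have h_ground : h o = 0 := hg.unitPotential_ground
  have h_self : h q = 1 := unitPotential_self hq
  have ψ_ground : ψ o = 0 := by rw [ψ_def, Pi.sub_apply, hg.ground, hg.ground, sub_self]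
  have ψ_self : ψ q = 0 := sub_self _
  have h_energy (F : Γ.V → ℝ) : Γ.energy h F = (F q - F o) / g q q := hg.energy_unitPotential F
  have h_sum := hg.energy_parabola_of_eq_zero ψ_ground ψ_self
  rw [← h_def] at h_sum
  have φ_eq : φ = (fun _ => a) + (b - a) • h + κ • (h * (1 - h)) + ψ := funext hφ
  rw [← hg.energy_diag_sub, φ_eq]
  simp only [map_add, map_smul, LinearMap.add_apply, LinearMap.smul_apply, energy_const_left,
    energy_const_right, energy_comm ψ, energy_comm _ h, smul_eq_mul]
  simp only [h_energy, h_sum, Pi.mul_apply, Pi.sub_apply, Pi.one_apply, ψ_ground, ψ_self,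
    h_ground, h_self]
  simp only [ψ_def, Pi.sub_apply]
  ring

theorem A_div_sq (hg : Γ.IsGreen o g) (hΓ : Γ.IsMetrizedGraph) (hq : g q q ≠ 0) :
    Γ.A (.vertex o) (.vertex q) / g q q ^ 2 =
      (∑ e, (unitPotential g q (Γ.tgt e) - unitPotential g q (Γ.src e)) ^ 2 / Γ.len e *
        (g (Γ.src e) (Γ.src e) - g q (Γ.src e) + (g (Γ.tgt e) (Γ.tgt e) - g q (Γ.tgt e)))) / 2 +
      (∑ e, (unitPotential g q (Γ.tgt e) - unitPotential g q (Γ.src e)) ^ 2 / Γ.len e *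
        (Γ.len e - kernelRes g (Γ.src e) (Γ.tgt e))) / 6 := by
  rw [hg.A_eq hΓ, Finset.sum_div, Finset.sum_div, Finset.sum_div, ← Finset.sum_add_distrib]
  refine Finset.sum_congr rfl fun e _ => ?_
  have h_increment : g q (Γ.tgt e) - g q (Γ.src e) =
      g q q * (unitPotential g q (Γ.tgt e) - unitPotential g q (Γ.src e)) := by
    rw [mul_sub, mul_unitPotential hq, mul_unitPotential hq]
  rw [h_increment]
  field_simp

/-- The terms of `tauSum` from the edges of a copy of `Γ` that replaces an edge of length
`g q q`; see `IsEdgeReplacement.green_diag` and `IsEdgeReplacement.kernelRes_green`. -/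
theorem sum_replacement (hg : Γ.IsGreen o g) (hΓ : Γ.IsMetrizedGraph) (hq : g q q ≠ 0)
    (a b κ : ℝ) {φ : Γ.V → ℝ}
    (hφ : ∀ x, φ x = a + (b - a) * unitPotential g q x +
      κ * (unitPotential g q x * (1 - unitPotential g q x)) + (g x x - g q x)) :
    ∑ e, ((φ (Γ.tgt e) - φ (Γ.src e)) ^ 2 / Γ.len e +
        (Γ.len e - (kernelRes g (Γ.src e) (Γ.tgt e) -
          κ * (unitPotential g q (Γ.tgt e) - unitPotential g q (Γ.src e)) ^ 2)) ^ 2 /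
            (3 * Γ.len e)) =
      (b - a) ^ 2 / g q q + κ ^ 2 / (3 * g q q) +
        4 * κ * Γ.A (.vertex o) (.vertex q) / g q q ^ 2 + 4 * tauSum g - g q q := by
  have h_energy := hg.energy_replacement_diag hq a b κ hφ
  have h_parabola := hg.energy_unitPotential_parabola hq
  set h := unitPotential g q
  let ρ (e : Γ.E) : ℝ := kernelRes g (Γ.src e) (Γ.tgt e)
  have h_tau : 4 * tauSum g = Γ.energy (fun v => g v v) (fun v => g v v) +
      ∑ e, (Γ.len e - ρ e) ^ 2 / (3 * Γ.len e) := by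
    rw [tauSum, energy_apply, ← Finset.sum_add_distrib, ← mul_assoc]
    norm_num [ρ, sq]
  have h_A := hg.A_div_sq hΓ hq
  have h_split : ∑ e, ((φ (Γ.tgt e) - φ (Γ.src e)) ^ 2 / Γ.len e +
        (Γ.len e - (ρ e - κ * (h (Γ.tgt e) - h (Γ.src e)) ^ 2)) ^ 2 / (3 * Γ.len e)) =
      Γ.energy φ φ + ∑ e, (Γ.len e - ρ e) ^ 2 / (3 * Γ.len e) +
        2 / 3 * κ * (∑ e, (h (Γ.tgt e) - h (Γ.src e)) ^ 2 / Γ.len e * (Γ.len e - ρ e)) +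
        κ ^ 2 / 3 * ∑ e, (h (Γ.tgt e) - h (Γ.src e)) ^ 4 / Γ.len e := by
    rw [energy_apply, Finset.mul_sum, Finset.mul_sum, ← Finset.sum_add_distrib,
      ← Finset.sum_add_distrib, ← Finset.sum_add_distrib]
    exact Finset.sum_congr rfl fun e _ => by field_simp; ring
  linear_combination h_split + h_energy + κ ^ 2 * h_parabola - 4 * κ * h_A - h_tau

end IsGreen
/-! ### Replacing the edges of a graph -/

/-- `M` is obtained from `Γ` by replacing each edge `e` by a copy of `B e`, glued at `p e` and
`q e`. The maps `ι` and `i e` give the position in `M` of the vertices of `Γ` and of `B e`. A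
function on the vertices of `M` amounts to functions on the vertices of `Γ` and of each `B e` that
agree where they are glued, and the edges of `M` are those of the copies; the latter is expressed
through sums, so that no edge of `M` has to be named. -/
structure IsEdgeReplacement (Γ M : LengthGraph.{u}) {B : Γ.E → LengthGraph.{u}}
    (p q : ∀ e, (B e).V) (ι : Γ.V → M.V) (i : ∀ e, (B e).V → M.V) : Prop where
  map_p : ∀ e, i e (p e) = ι (Γ.src e)
  map_q : ∀ e, i e (q e) = ι (Γ.tgt e)
  exists_glue : ∀ (w : Γ.V → ℝ) (u : ∀ e, (B e).V → ℝ), (∀ e, u e (p e) = w (Γ.src e)) →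
    (∀ e, u e (q e) = w (Γ.tgt e)) →
      ∃ F : M.V → ℝ, (∀ v, F (ι v) = w v) ∧ ∀ e x, F (i e x) = u e x
  sum_edges : ∀ φ : M.V → M.V → ℝ → ℝ, ∑ f, φ (M.src f) (M.tgt f) (M.len f) =
    ∑ e, ∑ f, φ (i e ((B e).src f)) (i e ((B e).tgt f)) ((B e).len f)

namespace IsEdgeReplacement

variable {M : LengthGraph.{u}} {B : Γ.E → LengthGraph.{u}} {p q : ∀ e, (B e).V} {ι : Γ.V → M.V}
  {i : ∀ e, (B e).V → M.V}

theorem energy_eq_sum (hM : IsEdgeReplacement Γ M p q ι i) (F H : M.V → ℝ) :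
    M.energy F H = ∑ e, (B e).energy (fun x => F (i e x)) fun x => H (i e x) := by
  simp only [energy_apply]
  exact hM.sum_edges fun x y l => (F y - F x) * (H y - H x) / l

variable {o : Γ.V} {G : Γ.V → Γ.V → ℝ} {K : M.V → M.V → ℝ} {g : ∀ e, (B e).V → (B e).V → ℝ}

/-- The extension of `G v` that is harmonic inside the copies is the Green function of `M`. -/
theorem green_vertex (hM : IsEdgeReplacement Γ M p q ι i) (hG : Γ.IsGreen o G)
    (hK : M.IsGreen (ι o) K) (hg : ∀ e, (B e).IsGreen (p e) (g e))
    (hL : ∀ e, g e (q e) (q e) = Γ.len e) (hΓ : ∀ e, Γ.len e ≠ 0) (v : Γ.V) (e : Γ.E)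
    (x : (B e).V) :
    K (i e x) (ι v) =
      G v (Γ.src e) + (G v (Γ.tgt e) - G v (Γ.src e)) * unitPotential (g e) (q e) x := by
  have hq (e : Γ.E) : g e (q e) (q e) ≠ 0 := (hL e).symm ▸ hΓ e
  obtain ⟨F, hF_vertex, hF_copy⟩ := hM.exists_glue (G v)
    (fun e x => G v (Γ.src e) + (G v (Γ.tgt e) - G v (Γ.src e)) * unitPotential (g e) (q e) x)
    (fun e => by rw [(hg e).unitPotential_ground, mul_zero, add_zero])
    (fun e => by rw [unitPotential_self (hq e), mul_one, add_sub_cancel])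
  have h_extension (e : Γ.E) : (fun x => F (i e x)) = (fun _ => G v (Γ.src e)) +
      (G v (Γ.tgt e) - G v (Γ.src e)) • unitPotential (g e) (q e) := funext (hF_copy e)
  have h_energy (H : M.V → ℝ) : M.energy F H = Γ.energy (G v) fun u => H (ι u) := by
    rw [hM.energy_eq_sum, energy_apply]
    refine Finset.sum_congr rfl fun e _ => ?_
    rw [h_extension, map_add, map_smul, LinearMap.add_apply, LinearMap.smul_apply,
      energy_const_left, (hg e).energy_unitPotential, hL, hM.map_p, hM.map_q, zero_add,
      smul_eq_mul, mul_div_assoc]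
  have h_test := h_energy (K (i e x))
  rw [energy_comm, hK.energy_eq, hG.energy_eq, hF_vertex, hG.ground, hK.ground, hF_copy] at h_test
  linarith

/-- The Green function of a copy grounded at both of its glued vertices, extended by zero, measures
the failure of the Green function of `M` to be harmonic inside the copy. -/
theorem green_copy (hM : IsEdgeReplacement Γ M p q ι i) (hK : M.IsGreen (ι o) K)
    (hg : ∀ e, (B e).IsGreen (p e) (g e)) {e : Γ.E} (hq : g e (q e) (q e) ≠ 0) (x y : (B e).V) :
    K (i e x) (i e y) = (1 - unitPotential (g e) (q e) y) * K (i e x) (ι (Γ.src e)) +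
      unitPotential (g e) (q e) y * K (i e x) (ι (Γ.tgt e)) +
      (g e y x - unitPotential (g e) (q e) y * g e (q e) x) := by
  classical
  let D : (B e).V → ℝ := g e y - unitPotential (g e) (q e) y • g e (q e)
  have hD (x : (B e).V) : D x = g e y x - unitPotential (g e) (q e) y * g e (q e) x := rfl
  have hD_q : D (q e) = 0 := by
    rw [hD, mul_comm, mul_unitPotential hq, (hg e).symm, sub_self]
  obtain ⟨F, hF_vertex, hF_copy⟩ := hM.exists_glue (fun _ => 0) (Pi.single e D)
    (fun e' => by
      obtain rfl | h := eq_or_ne e' e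
      · rw [Pi.single_eq_same, hD, (hg e').ground, (hg e').ground, mul_zero, sub_zero]
      · rw [Pi.single_eq_of_ne h, Pi.zero_apply])
    (fun e' => by
      obtain rfl | h := eq_or_ne e' e
      · rw [Pi.single_eq_same, hD_q]
      · rw [Pi.single_eq_of_ne h, Pi.zero_apply])
  have h_energy : M.energy F (K (i e x)) = (B e).energy D fun z => K (i e x) (i e z) := by
    rw [hM.energy_eq_sum, Finset.sum_eq_single e]
    · simp only [hF_copy, Pi.single_eq_same]
    · intro e' _ h
      simp only [hF_copy, Pi.single_eq_of_ne h, Pi.zero_apply, energy_const_left]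
    · exact fun h => absurd (Finset.mem_univ e) h
  rw [energy_comm, hK.energy_eq, hF_vertex, hF_copy, Pi.single_eq_same, hD, map_sub, map_smul,
    LinearMap.sub_apply, LinearMap.smul_apply, (hg e).energy_eq, (hg e).energy_eq, hM.map_p,
    hM.map_q, smul_eq_mul] at h_energy
  linarith

section

variable (hM : IsEdgeReplacement Γ M p q ι i) (hG : Γ.IsGreen o G) (hK : M.IsGreen (ι o) K)
  (hg : ∀ e, (B e).IsGreen (p e) (g e)) (hL : ∀ e, g e (q e) (q e) = Γ.len e)
  (hΓ : ∀ e, Γ.len e ≠ 0)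
include hM hG hK hg hL hΓ

theorem green_copy_copy (e : Γ.E) (x y : (B e).V) :
    K (i e x) (i e y) =
      (1 - unitPotential (g e) (q e) y) * (1 - unitPotential (g e) (q e) x) *
          G (Γ.src e) (Γ.src e) +
        (unitPotential (g e) (q e) x + unitPotential (g e) (q e) y -
          2 * unitPotential (g e) (q e) x * unitPotential (g e) (q e) y) *
            G (Γ.src e) (Γ.tgt e) +
        unitPotential (g e) (q e) y * unitPotential (g e) (q e) x * G (Γ.tgt e) (Γ.tgt e) +
        (g e x y - Γ.len e * unitPotential (g e) (q e) x * unitPotential (g e) (q e) y) := by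
  have hq : g e (q e) (q e) ≠ 0 := (hL e).symm ▸ hΓ e
  rw [hM.green_copy hK hg hq, hM.green_vertex hG hK hg hL hΓ, hM.green_vertex hG hK hg hL hΓ,
    ← mul_unitPotential hq x, hL, (hg e).symm y x, hG.symm (Γ.tgt e) (Γ.src e)]
  ring

theorem green_diag (e : Γ.E) (x : (B e).V) :
    K (i e x) (i e x) = G (Γ.src e) (Γ.src e) +
      (G (Γ.tgt e) (Γ.tgt e) - G (Γ.src e) (Γ.src e)) * unitPotential (g e) (q e) x +
      (Γ.len e - kernelRes G (Γ.src e) (Γ.tgt e)) *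
        (unitPotential (g e) (q e) x * (1 - unitPotential (g e) (q e) x)) +
      (g e x x - g e (q e) x) := by
  have hq : g e (q e) (q e) ≠ 0 := (hL e).symm ▸ hΓ e
  rw [hM.green_copy_copy hG hK hg hL hΓ, ← mul_unitPotential hq x, hL, kernelRes]
  ring

theorem kernelRes_green (e : Γ.E) (x y : (B e).V) :
    kernelRes K (i e x) (i e y) = kernelRes (g e) x y -
      (Γ.len e - kernelRes G (Γ.src e) (Γ.tgt e)) *
        (unitPotential (g e) (q e) y - unitPotential (g e) (q e) x) ^ 2 := by
  simp only [kernelRes, hM.green_copy_copy hG hK hg hL hΓ]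
  ring

end

theorem tau_eq (hM : IsEdgeReplacement Γ M p q ι i) (hM' : M.IsMetrizedGraph)
    (hΓ : Γ.IsMetrizedGraph) (hB : ∀ e, (B e).IsMetrizedGraph)
    (hr : ∀ e, (B e).resistance (.vertex (p e)) (.vertex (q e)) = Γ.len e) :
    M.tau = Γ.tau - Γ.totalLength / 4 +
      ∑ e, ((B e).tau + (B e).A (.vertex (p e)) (.vertex (q e)) * Γ.invLenAddRes e) := by
  obtain ⟨o⟩ := hΓ.1.1
  obtain ⟨G, hG⟩ := hΓ.exists_isGreen o
  obtain ⟨K, hK⟩ := hM'.exists_isGreen (ι o)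
  choose g hg using fun e => (hB e).exists_isGreen (p e)
  have hL (e : Γ.E) : g e (q e) (q e) = Γ.len e :=
    ((hg e).resistance_ground (hB e) (q e)).symm.trans (hr e)
  have hl (e : Γ.E) : Γ.len e ≠ 0 := (hΓ.2 e).ne'
  rw [hK.tau_eq hM', hG.tau_eq hΓ, tauSum, tauSum, totalLength, hM.sum_edges fun x y l =>
    (K y y - K x x) ^ 2 / l + (l - kernelRes K x y) ^ 2 / (3 * l), Finset.mul_sum, Finset.mul_sum,
    Finset.sum_div, ← Finset.sum_sub_distrib, ← Finset.sum_add_distrib]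
  refine Finset.sum_congr rfl fun e _ => ?_
  have h_inv := hΓ.len_sq_mul_invLenAddRes e
  rw [hG.resistance_vertex hΓ] at h_inv
  simp only [hM.kernelRes_green hG hK hg hL hl]
  rw [(hg e).sum_replacement (hB e) ((hL e).symm ▸ hl e) _ _ _
    (hM.green_diag hG hK hg hL hl e), (hg e).tau_eq (hB e), hL, ← h_inv]
  field_simp [hl e]
  ring

end IsEdgeReplacement
/-! ### Full immersions -/

namespace IsMetrizedGraph

theorem resistance_pos (hΓ : Γ.IsMetrizedGraph) {x y : Γ.V} (hxy : x ≠ y) :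
    0 < Γ.resistance (.vertex x) (.vertex y) := by
  obtain ⟨g, hg⟩ := hΓ.exists_isGreen x
  rw [hg.resistance_ground hΓ]
  exact hg.diag_pos hΓ hxy.symm

theorem totalLength_pos_iff (hΓ : Γ.IsMetrizedGraph) : 0 < Γ.totalLength ↔ Nonempty Γ.E := by
  refine ⟨fun h => ?_, fun _ => Finset.sum_pos (fun e _ => hΓ.2 e) Finset.univ_nonempty⟩
  by_contra hE
  rw [not_nonempty_iff] at hE
  exact h.ne' (Finset.sum_of_isEmpty _)

theorem nonempty_edge (hΓ : Γ.IsMetrizedGraph) {x y : Γ.V} (hxy : x ≠ y) : Nonempty Γ.E := by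
  by_contra hE
  rw [not_nonempty_iff] at hE
  exact hxy (eq_of_eqvGen_of_forall_edge (F := id) hE.elim (hΓ.1.2 x y))

end IsMetrizedGraph

section Immersion

variable {β : Γ.E → LengthGraph.{u}} {p q : ∀ e, (β e).V}

theorem immersionVertex_p (e : Γ.E) : Γ.immersionVertex β p q e (p e) = .inl (Γ.src e) :=
  dif_pos rfl

theorem immersionVertex_q {e : Γ.E} (hpq : p e ≠ q e) :
    Γ.immersionVertex β p q e (q e) = .inl (Γ.tgt e) :=
  (dif_neg hpq.symm).trans (dif_pos rfl)

theorem immersionVertex_of_ne {e : Γ.E} {v : (β e).V} (hv : v ≠ p e ∧ v ≠ q e) :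
    Γ.immersionVertex β p q e v = .inr ⟨e, v, hv⟩ :=
  (dif_neg hv.1).trans (dif_neg hv.2)

theorem isEdgeReplacement_fullImmersion (hpq : ∀ e, p e ≠ q e) :
    IsEdgeReplacement Γ (Γ.fullImmersion β p q) (B := Γ.scaledCopy β p q) p q .inl
      (Γ.immersionVertex β p q) where
  map_p := immersionVertex_p
  map_q e := immersionVertex_q (hpq e)
  exists_glue w u hp hq := by
    refine ⟨Sum.elim w fun x => u x.1 x.2.1, fun v => rfl, fun e (x : (β e).V) => ?_⟩
    by_cases hxp : x = p e
    · rw [hxp, immersionVertex_p]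
      exact (hp e).symm
    by_cases hxq : x = q e
    · rw [hxq, immersionVertex_q (hpq e)]
      exact (hq e).symm
    · rw [immersionVertex_of_ne ⟨hxp, hxq⟩]
      rfl
  sum_edges φ := Fintype.sum_sigma _

theorem Connected.fullImmersion (hΓ : Γ.Connected) (hβ : ∀ e, (β e).Connected)
    (hpq : ∀ e, p e ≠ q e) : (Γ.fullImmersion β p q).Connected := by
  let component : Γ.ImmersionVertex β p q → Quot (Γ.fullImmersion β p q).EdgeRel := Quot.mk _
  have h_copy (e : Γ.E) (x y : (β e).V) :
      component (Γ.immersionVertex β p q e x) = component (Γ.immersionVertex β p q e y) :=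
    eq_of_eqvGen_of_forall_edge (F := fun x => component (Γ.immersionVertex β p q e x))
      (fun f => Quot.sound ⟨⟨e, f⟩, rfl, rfl⟩) ((hβ e).2 x y)
  have h_vertex (u v : Γ.V) : component (.inl u) = component (.inl v) :=
    eq_of_eqvGen_of_forall_edge (F := fun u => component (.inl u))
      (fun e => by
        simpa only [immersionVertex_p, immersionVertex_q (hpq e)] using h_copy e (p e) (q e))
      (hΓ.2 u v)
  obtain ⟨o⟩ := hΓ.1
  have h_component (x : Γ.ImmersionVertex β p q) : component x = component (.inl o) := by
    obtain v | ⟨e, v, hv⟩ := x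
    · exact h_vertex v o
    · rw [← immersionVertex_of_ne hv, h_copy e v (p e), immersionVertex_p]
      exact h_vertex _ o
  exact ⟨⟨.inl o⟩, fun x y => Quot.eqvGen_exact ((h_component x).trans (h_component y).symm)⟩

theorem totalLength_fullImmersion : (Γ.fullImmersion β p q).totalLength =
    ∑ e, Γ.len e / (β e).resistance (.vertex (p e)) (.vertex (q e)) * (β e).totalLength :=
  (Fintype.sum_sigma _).trans (Finset.sum_congr rfl fun e _ => totalLength_scale (β e)
    (Γ.len e / (β e).resistance (.vertex (p e)) (.vertex (q e))))

namespace IsMetrizedGraph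

section

variable (hΓ : Γ.IsMetrizedGraph) (hβ : ∀ e, (β e).IsMetrizedGraph) (hpq : ∀ e, p e ≠ q e)
include hΓ hβ hpq

theorem len_div_resistance_pos (e : Γ.E) :
    0 < Γ.len e / (β e).resistance (.vertex (p e)) (.vertex (q e)) :=
  div_pos (hΓ.2 e) ((hβ e).resistance_pos (hpq e))

theorem fullImmersion : (Γ.fullImmersion β p q).IsMetrizedGraph :=
  ⟨hΓ.1.fullImmersion (fun e => (hβ e).1) hpq,
    fun f => mul_pos (hΓ.len_div_resistance_pos hβ hpq f.1) ((hβ f.1).2 f.2)⟩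

theorem totalLength_fullImmersion_pos (hℓ : 0 < Γ.totalLength) :
    0 < (Γ.fullImmersion β p q).totalLength := by
  obtain ⟨e⟩ := hΓ.totalLength_pos_iff.1 hℓ
  obtain ⟨f⟩ := (hβ e).nonempty_edge (hpq e)
  exact (hΓ.fullImmersion hβ hpq).totalLength_pos_iff.2 ⟨⟨e, f⟩⟩

theorem tau_fullImmersion : (Γ.fullImmersion β p q).tau = Γ.tau - Γ.totalLength / 4 +
    ∑ e, (Γ.len e * (β e).tau / (β e).resistance (.vertex (p e)) (.vertex (q e)) +
      Γ.len e ^ 2 * (β e).A (.vertex (p e)) (.vertex (q e)) * Γ.invLenAddRes e /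
        (β e).resistance (.vertex (p e)) (.vertex (q e)) ^ 2) := by
  have h_pos := hΓ.len_div_resistance_pos hβ hpq
  have h_resistance (e : Γ.E) :
      (Γ.scaledCopy β p q e).resistance (.vertex (p e)) (.vertex (q e)) = Γ.len e :=
    ((hβ e).resistance_scale (h_pos e) (p e) (q e)).trans
      (div_mul_cancel₀ _ ((hβ e).resistance_pos (hpq e)).ne')
  refine ((isEdgeReplacement_fullImmersion hpq).tau_eq (hΓ.fullImmersion hβ hpq) hΓ
    (fun e => (hβ e).scale (h_pos e)) h_resistance).trans
      (congrArg _ (Finset.sum_congr rfl fun e _ => ?_))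
  refine (congrArg₂ (· + · * Γ.invLenAddRes e) ((hβ e).tau_scale (h_pos e))
    ((hβ e).A_scale (h_pos e) (p e) (q e))).trans ?_
  ring

end

theorem tau_normalization_mul_totalLength (hΓ : Γ.IsMetrizedGraph) (hℓ : 0 < Γ.totalLength) :
    Γ.normalization.tau * Γ.totalLength = Γ.tau := by
  rw [normalization, hΓ.tau_scale (one_div_pos.2 hℓ), one_div_mul_eq_div,
    div_mul_cancel₀ _ hℓ.ne']

theorem isNormalized_normalization_fullImmersion (hΓ : Γ.IsMetrizedGraph)
    (hℓ : 0 < Γ.totalLength) (hβ : ∀ e, (β e).IsMetrizedGraph) (hpq : ∀ e, p e ≠ q e) :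
    (Γ.fullImmersion β p q).normalization.IsNormalized :=
  (hΓ.fullImmersion hβ hpq).isNormalized_normalization
    (hΓ.totalLength_fullImmersion_pos hβ hpq hℓ)

theorem tau_normalization_fullImmersion (hΓ : Γ.IsMetrizedGraph) (hℓ : 0 < Γ.totalLength)
    (hβ : ∀ e, (β e).IsMetrizedGraph) (hpq : ∀ e, p e ≠ q e) :
    (Γ.fullImmersion β p q).normalization.tau *
        ∑ e, Γ.len e / (β e).resistance (.vertex (p e)) (.vertex (q e)) * (β e).totalLength =
      Γ.tau - Γ.totalLength / 4 +
        ∑ e, (Γ.len e * (β e).tau / (β e).resistance (.vertex (p e)) (.vertex (q e)) +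
          Γ.len e ^ 2 * (β e).A (.vertex (p e)) (.vertex (q e)) * Γ.invLenAddRes e /
            (β e).resistance (.vertex (p e)) (.vertex (q e)) ^ 2) := by
  rw [← totalLength_fullImmersion, ← hΓ.tau_fullImmersion hβ hpq]
  exact (hΓ.fullImmersion hβ hpq).tau_normalization_mul_totalLength
    (hΓ.totalLength_fullImmersion_pos hβ hpq hℓ)

theorem tau_normalization_fullImmersion_const {β : LengthGraph.{u}} {p q : β.V}
    (hΓ : Γ.IsMetrizedGraph) (hℓ : 0 < Γ.totalLength) (hβ : β.IsMetrizedGraph) (hpq : p ≠ q) :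
    (Γ.fullImmersion (fun _ => β) (fun _ => p) (fun _ => q)).normalization.tau *
        (Γ.totalLength * β.totalLength) =
      Γ.totalLength * β.tau - β.resistance (.vertex p) (.vertex q) * Γ.totalLength / 4 +
        β.resistance (.vertex p) (.vertex q) * Γ.tau +
        β.A (.vertex p) (.vertex q) / β.resistance (.vertex p) (.vertex q) *
          ∑ e, Γ.len e ^ 2 * Γ.invLenAddRes e := by
  have hr := (hβ.resistance_pos hpq).ne'
  have h_tau := hΓ.tau_normalization_fullImmersion (p := fun _ => p) hℓ (fun _ => hβ) fun _ => hpq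
  rw [← Finset.sum_mul, ← Finset.sum_div, Finset.sum_add_distrib, ← Finset.sum_div,
    ← Finset.sum_div, ← Finset.sum_mul, ← totalLength] at h_tau
  simp only [mul_right_comm _ (β.A _ _)] at h_tau
  rw [← Finset.sum_mul] at h_tau
  field_simp at h_tau ⊢
  linear_combination h_tau

end IsMetrizedGraph

end Immersion

end LengthGraph

theorem mainTheorem1_general :
    (∀ (Γ β : LengthGraph.{u}) (p q : β.V),
      Γ.IsMetrizedGraph → 0 < Γ.totalLength → β.IsMetrizedGraph → p ≠ q →
      (Γ.fullImmersion (fun _ => β) (fun _ => p) (fun _ => q)).normalization.IsNormalized ∧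
      (Γ.fullImmersion (fun _ => β) (fun _ => p) (fun _ => q)).normalization.tau *
          (Γ.totalLength * β.totalLength) =
        Γ.totalLength * β.tau - β.resistance (.vertex p) (.vertex q) * Γ.totalLength / 4
          + β.resistance (.vertex p) (.vertex q) * Γ.tau
          + β.A (.vertex p) (.vertex q) / β.resistance (.vertex p) (.vertex q) *
            ∑ e : Γ.E, Γ.len e ^ 2 * Γ.invLenAddRes e) ∧
    (∀ (Γ : LengthGraph.{u}) (β : Γ.E → LengthGraph.{u}) (p q : ∀ e, (β e).V),
      Γ.IsMetrizedGraph → 0 < Γ.totalLength → (∀ e, (β e).IsMetrizedGraph) →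
      (∀ e, p e ≠ q e) →
      (Γ.fullImmersion β p q).normalization.IsNormalized ∧
      (Γ.fullImmersion β p q).normalization.tau *
          ∑ e : Γ.E, Γ.len e / (β e).resistance (.vertex (p e)) (.vertex (q e)) *
            (β e).totalLength =
        Γ.tau - Γ.totalLength / 4 +
          ∑ e : Γ.E,
            (Γ.len e * (β e).tau / (β e).resistance (.vertex (p e)) (.vertex (q e)) +
              Γ.len e ^ 2 * (β e).A (.vertex (p e)) (.vertex (q e)) * Γ.invLenAddRes e /
                (β e).resistance (.vertex (p e)) (.vertex (q e)) ^ 2)) :=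
  ⟨fun _ _ _ _ hΓ hℓ hβ hpq =>
    ⟨hΓ.isNormalized_normalization_fullImmersion hℓ (fun _ => hβ) fun _ => hpq,
      hΓ.tau_normalization_fullImmersion_const hℓ hβ hpq⟩,
    fun _ _ _ _ hΓ hℓ hβ hpq =>
      ⟨hΓ.isNormalized_normalization_fullImmersion hℓ hβ hpq,
        hΓ.tau_normalization_fullImmersion hℓ hβ hpq⟩⟩

theorem mainTheorem1 :
    (∀ (Γ β : LengthGraph.{u}) (p q : β.V),
      Γ.IsNormalized → β.IsNormalized → p ≠ q →
      (Γ.fullImmersion (fun _ => β) (fun _ => p) (fun _ => q)).normalization.IsNormalized ∧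
      (Γ.fullImmersion (fun _ => β) (fun _ => p) (fun _ => q)).normalization.tau =
        β.tau - β.resistance (.vertex p) (.vertex q) / 4
          + β.resistance (.vertex p) (.vertex q) * Γ.tau
          + β.A (.vertex p) (.vertex q) / β.resistance (.vertex p) (.vertex q) *
            ∑ e : Γ.E, Γ.len e ^ 2 * Γ.invLenAddRes e) ∧
    (∀ (Γ : LengthGraph.{u}) (β : Γ.E → LengthGraph.{u}) (p q : ∀ e, (β e).V),
      Γ.IsNormalized → (∀ e, (β e).IsNormalized) → (∀ e, p e ≠ q e) →
      (Γ.fullImmersion β p q).normalization.IsNormalized ∧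
      (Γ.fullImmersion β p q).normalization.tau *
          ∑ e : Γ.E, Γ.len e / (β e).resistance (.vertex (p e)) (.vertex (q e)) =
        Γ.tau - 1 / 4 +
          ∑ e : Γ.E,
            (Γ.len e * (β e).tau / (β e).resistance (.vertex (p e)) (.vertex (q e)) +
              Γ.len e ^ 2 * (β e).A (.vertex (p e)) (.vertex (q e)) * Γ.invLenAddRes e /
                (β e).resistance (.vertex (p e)) (.vertex (q e)) ^ 2)) := by
  refine ⟨fun Γ β p q hΓ hβ hpq => ?_, fun Γ β p q hΓ hβ hpq => ?_⟩
  · simpa only [hΓ.2, hβ.2, mul_one, one_mul] using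
      mainTheorem1_general.1 Γ β p q hΓ.1 (hΓ.2 ▸ one_pos) hβ.1 hpq
  · simpa only [hΓ.2, (hβ _).2, mul_one] using
      mainTheorem1_general.2 Γ β p q hΓ.1 (hΓ.2 ▸ one_pos) (fun e => (hβ e).1) hpq
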